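/- **Conventions.** A *2-complex* $X$ is a combinatorial one: it consists of vertices (0-cells), edges (1-cells) and 2-cells, where each 2-cell $R$ is a polygon with $n\ge 1$ sides whose boundary cycle is attached along a closed edge path of length $n$ without backtracking (that is, attaching maps are immersions). A *(combinatorial) map* sends vertices to vertices, edges to edges (respecting endpoints, possibly reversing the reference orientation), and each 2-cell onto a 2-cell by an isomorphism of polygons compatible with the attaching maps. It is a *1-immersion* if it is locally injective on the 1-skeleton, i.e. injective on the oriented edges leaving each vertex. It is a *covering* if it is bijective from the oriented edges leaving each vertex $v$ to those leaving the image of $v$, and bijective from the directed sides of 2-cells attached at each oriented edge $d$ to those attached at the image of $d$. A *subcomplex* is a set of cells that contains the boundaries of its cells. *Compact* means having finitely many cells; *connected* means nonempty and edge-path connected. $\pi_1(X,x)$ is the group of closed edge paths at the vertex $x$ modulo insertion and deletion of backtracks and of boundary cycles of 2-cells. A map is *$\pi_1$-injective* if it induces injective homomorphisms of fundamental groups at all base vertices. A group is *coherent* if all its finitely generated subgroups are finitely presented. A *side* of $X$ is a pair $(R,r)$ consisting of a 2-cell $R$ of $X$ and an edge $r$ of the polygon $R$; it is *present* at the edge $x$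 of $X$ to which $r$ is glued. Given a map $\phi\colon Y\to X$ and an edge $y$ of $Y$, a side of $X$ present at $\phi(y)$ is *missing at $y$* if it is not the image under $\phi$ of a side of $Y$ present at $y$. A *weighted 2-complex* is a 2-complex $X$ with a weight $\mathrm{Wt}(R,r)\in\mathbb Z_{\ge 0}$ for each side, such that for each edge the sum of the weights of the sides present at it is finite and for each 2-cell the sum of the weights of its sides is positive. For a map $\phi\colon Y\to X$ with $Y$ compact, the *perimeter* is $$\mathbf P(Y)=\mathbf P(\phi)=\sum_{y\in \mathrm{Edges}(Y)}\ \sum_{(R,r)\ \text{missing at } y}\mathrm{Wt}(R,r).$$ For a subcomplex $Y$ of a cover $\widehat X\to X$, $\mathbf P(Y)$ is the perimeter of the composite $Y\hookrightarrow\widehat X\to X$. $X$ satisfies the *perimeter reduction hypothesis* if for every 1-immersion $\phi\colon Y\to X$ with $Y$ compact and connected which is not $\pi_1$-injective, and every base vertex $y$ of $Y$, there are a compact connected $Y^+$ and maps $\iota\colon Y\to Y^+$, $\phi^+\colon Y^+\to X$ with $\phi^+\circ\iota=\phi$, $\mathbf P(\phi^+)<\mathbf P(\phi)$, and $\phi^+_*(\pi_1(Y^+,\iota(y)))=\phi_*(\pi_1(Y,y))$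 in $\pi_1(X,\phi(y))$. **Theorem (Coherence theorem).** Let $X$ be a weighted 2-complex which satisfies the perimeter reduction hypothesis, and let $\widehat X\to X$ be a cover. (A) If $Y$ is a compact connected subcomplex of $\widehat X$ and the inclusion $Y\to\widehat X$ is not $\pi_1$-injective, then $Y$ is contained in a compact connected subcomplex $Y'$ of $\widehat X$ such that $\mathbf P(Y')<\mathbf P(Y)$. (B) If $\widehat X$ is connected, then for any compact subcomplex $C\subset\widehat X$ there exists a compact connected subcomplex $Y\subset\widehat X$ containing $C$ such that $\mathbf P(Y)$ is minimal among all compact connected subcomplexes of $\widehat X$ containing $C$. Consequently, $\pi_1(X,x)$ is coherent for every vertex $x$ of $X$. -/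

import Mathlib

universe u

/-- A combinatorial 2-complex: vertices, edges (each with a reference orientation), and polygonal
2-cells. The 2-cell `c` is a polygon with `len c ≥ 1` sides, numbered cyclically by `ZMod (len c)`;
its `i`-th side is glued to the oriented edge `bd c i`, where `(e, true)` is the edge `e` with its
reference orientation and `(e, false)` is the same edge with the opposite orientation.
Attaching maps of 2-cells are closed paths and are immersions (no backtracking). -/
structure TwoComplex where
  Vert : Type u
  Edge : Type u
  Cell : Type u
  src : Edge → Vert
  tgt : Edge → Vert
  len : Cell → ℕ
  len_pos : ∀ c, 0 < len c
  bd : (c : Cell) → ZMod (len c) → Edge × Bool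
  bd_closed : ∀ (c : Cell) (i : ZMod (len c)),
    (bif (bd c i).2 then tgt (bd c i).1 else src (bd c i).1) =
      (bif (bd c (i + 1)).2 then src (bd c (i + 1)).1 else tgt (bd c (i + 1)).1)
  bd_immersed : ∀ (c : Cell) (i : ZMod (len c)), bd c (i + 1) ≠ ((bd c i).1, !(bd c i).2)

namespace TwoComplex

/-! ### Oriented edges, sides, oriented sides -/

/-- Oriented edges. -/
abbrev Dart (X : TwoComplex.{u}) : Type u := X.Edge × Bool

/-- The oppositely oriented edge. -/
def rev {X : TwoComplex.{u}} (d : X.Dart) : X.Dart := (d.1, !d.2)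

/-- The initial vertex of an oriented edge. -/
def org {X : TwoComplex.{u}} (d : X.Dart) : X.Vert := bif d.2 then X.src d.1 else X.tgt d.1

/-- The terminal vertex of an oriented edge. -/
def dst {X : TwoComplex.{u}} (d : X.Dart) : X.Vert := bif d.2 then X.tgt d.1 else X.src d.1

/-- Sides `(R, r)`: a 2-cell `R` together with a 1-cell `r` of the boundary of the polygon `R`. -/
abbrev Side (X : TwoComplex.{u}) : Type u := Σ c : X.Cell, ZMod (X.len c)

/-- The edge of `X` at which a side is present. -/
def Side.edge {X : TwoComplex.{u}} (s : X.Side) : X.Edge := (X.bd s.1 s.2).1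

/-- Oriented sides: a side of a 2-cell together with one of the two directions in which the
boundary of the polygon can be traversed (`true` is the direction of increasing numbers). -/
abbrev Flag (X : TwoComplex.{u}) : Type u := Σ c : X.Cell, ZMod (X.len c) × Bool

/-- The underlying (unoriented) side. -/
def Flag.side {X : TwoComplex.{u}} (f : X.Flag) : X.Side := ⟨f.1, f.2.1⟩

/-- The oriented edge of `X` to which an oriented side is glued. -/
def Flag.dart {X : TwoComplex.{u}} (f : X.Flag) : X.Dart :=
  bif f.2.2 then X.bd f.1 f.2.1 else rev (X.bd f.1 f.2.1)

/-- The oriented side that follows `f` when walking around the polygon in the direction of `f`. -/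
def Flag.next {X : TwoComplex.{u}} (f : X.Flag) : X.Flag :=
  ⟨f.1, bif f.2.2 then f.2.1 + 1 else f.2.1 - 1, f.2.2⟩

/-- The same side with the opposite direction. -/
def Flag.flip {X : TwoComplex.{u}} (f : X.Flag) : X.Flag := ⟨f.1, f.2.1, !f.2.2⟩

/-- The boundary path of the 2-cell of `f`, read once around, starting with the side `f` and in the
direction of `f`. -/
def Flag.boundary {X : TwoComplex.{u}} (f : X.Flag) : List X.Dart :=
  (List.range (X.len f.1)).map fun k => (Flag.next^[k] f).dart

@[simp] theorem rev_rev {X : TwoComplex.{u}} (d : X.Dart) : rev (rev d) = d := by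
  simp [rev]

@[simp] theorem org_rev {X : TwoComplex.{u}} (d : X.Dart) : org (rev d) = dst d := by
  rcases d with ⟨e, _ | _⟩ <;> rfl

@[simp] theorem dst_rev {X : TwoComplex.{u}} (d : X.Dart) : dst (rev d) = org d := by
  rcases d with ⟨e, _ | _⟩ <;> rfl

theorem Flag.next_iterate {X : TwoComplex.{u}} (f : X.Flag) (k : ℕ) :
    Flag.next^[k] f = ⟨f.1, bif f.2.2 then f.2.1 + k else f.2.1 - k, f.2.2⟩ := by
  induction k with
  | zero => rcases f with ⟨c, i, _ | _⟩ <;> simp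
  | succ k ih =>
    rw [Function.iterate_succ_apply', ih]
    rcases f with ⟨c, i, _ | _⟩
    · simp only [Flag.next, cond_false, Nat.cast_succ]; rw [sub_sub]
    · simp only [Flag.next, cond_true, Nat.cast_succ]; rw [add_assoc]

/-! ### Combinatorial maps -/

/-- A combinatorial map: vertices go to vertices, oriented edges to oriented edges, and every 2-cell
is carried to a 2-cell of the same length by an isomorphism of polygons. The isomorphism of polygons
is recorded by its effect on oriented sides. -/
@[ext] structure Hom (Y X : TwoComplex.{u}) where
  onVert : Y.Vert → X.Vert
  onDart : Y.Dart → X.Dart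
  onFlag : Y.Flag → X.Flag
  map_org : ∀ d, org (onDart d) = onVert (org d)
  map_rev : ∀ d, onDart (rev d) = rev (onDart d)
  map_dart : ∀ f, (onFlag f).dart = onDart f.dart
  map_next : ∀ f, onFlag f.next = (onFlag f).next
  map_flip : ∀ f, onFlag f.flip = (onFlag f).flip
  map_len : ∀ f, X.len (onFlag f).1 = Y.len f.1

namespace Hom

variable {X Y Z : TwoComplex.{u}}

/-- Composition of combinatorial maps. -/
def comp (g : Hom Y X) (f : Hom Z Y) : Hom Z X where
  onVert v := g.onVert (f.onVert v)
  onDart d := g.onDart (f.onDart d)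
  onFlag t := g.onFlag (f.onFlag t)
  map_org d := by rw [g.map_org, f.map_org]
  map_rev d := by rw [f.map_rev, g.map_rev]
  map_dart t := by rw [g.map_dart, f.map_dart]
  map_next t := by rw [f.map_next, g.map_next]
  map_flip t := by rw [f.map_flip, g.map_flip]
  map_len t := by rw [g.map_len, f.map_len]

/-- The effect of a map on edges. -/
def onEdge (f : Hom Y X) (e : Y.Edge) : X.Edge := (f.onDart (e, true)).1

/-- The effect of a map on sides of 2-cells. -/
def onSide (f : Hom Y X) (s : Y.Side) : X.Side := (f.onFlag ⟨s.1, s.2, true⟩).side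

/-- `f` is injective on the set of oriented edges leaving any given vertex, i.e. `f` restricts to
an immersion (a local injection) of 1-skeleta. -/
def IsOneImmersion (f : Hom Y X) : Prop :=
  ∀ v : Y.Vert, Set.InjOn f.onDart {d | org d = v}

/-- `f` is a covering map: it restricts to a bijection from the oriented edges leaving `v` to those
leaving `f v`, for every vertex `v`, and from the oriented sides glued to `d` to those glued to
`f d`, for every oriented edge `d`. In other words `f` induces isomorphisms of links of vertices. -/
structure IsCovering (f : Hom Y X) : Prop where
  bijOn_darts : ∀ v : Y.Vert, Set.BijOn f.onDart {d | org d = v} {d | org d = f.onVert v}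
  bijOn_flags : ∀ d : Y.Dart,
    Set.BijOn f.onFlag {t | t.dart = d} {t | t.dart = f.onDart d}

theorem map_dst (f : Hom Y X) (d : Y.Dart) : dst (f.onDart d) = f.onVert (dst d) := by
  rw [← org_rev, ← f.map_rev, f.map_org, org_rev]

theorem map_next_iterate (f : Hom Y X) (t : Y.Flag) (k : ℕ) :
    f.onFlag (Flag.next^[k] t) = Flag.next^[k] (f.onFlag t) := by
  induction k with
  | zero => rfl
  | succ k ih => rw [Function.iterate_succ_apply', f.map_next, ih, Function.iterate_succ_apply']

theorem map_boundary (f : Hom Y X) (t : Y.Flag) :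
    t.boundary.map f.onDart = (f.onFlag t).boundary := by
  simp [Flag.boundary, f.map_len, ← f.map_next_iterate, f.map_dart]

end Hom

/-! ### Edge paths and the fundamental group -/

/-- `IsPath v l w`: the list `l` of oriented edges is an edge path from `v` to `w`. -/
def IsPath {X : TwoComplex.{u}} : X.Vert → List X.Dart → X.Vert → Prop
  | v, [], w => v = w
  | v, d :: l, w => org d = v ∧ IsPath (dst d) l w

/-- Edge paths from `v` to `w`. -/
def EdgePath (X : TwoComplex.{u}) (v w : X.Vert) : Type u := {l : List X.Dart // IsPath v l w}

/-- Elementary homotopies: insert a backtrack, or insert the boundary path of a 2-cell. -/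
inductive Step {X : TwoComplex.{u}} : List X.Dart → List X.Dart → Prop
  | backtrack (l₁ l₂ : List X.Dart) (d : X.Dart) : Step (l₁ ++ l₂) (l₁ ++ [d, rev d] ++ l₂)
  | cell (l₁ l₂ : List X.Dart) (f : X.Flag) : Step (l₁ ++ l₂) (l₁ ++ f.boundary ++ l₂)

/-- Homotopy of edge paths relative to their endpoints: the equivalence relation generated by
elementary homotopies. -/
def Homotopic {X : TwoComplex.{u}} {v w : X.Vert} : X.EdgePath v w → X.EdgePath v w → Prop :=
  Relation.EqvGen fun a b => Step a.1 b.1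

/-- Homotopy of closed edge paths at `x`. -/
def loopSetoid (X : TwoComplex.{u}) (x : X.Vert) : Setoid (X.EdgePath x x) where
  r := Homotopic
  iseqv := Relation.EqvGen.is_equivalence _

/-- The (edge path) fundamental group of `X` at the vertex `x`: homotopy classes of closed edge
paths at `x`, with concatenation as multiplication. -/
def FundGroup (X : TwoComplex.{u}) (x : X.Vert) : Type u := Quotient (X.loopSetoid x)

section group

variable {X : TwoComplex.{u}}

theorem IsPath.append {l₁ l₂ : List X.Dart} {u v w : X.Vert} (h₁ : IsPath u l₁ v)
    (h₂ : IsPath v l₂ w) : IsPath u (l₁ ++ l₂) w := by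
  induction l₁ generalizing u with
  | nil => cases h₁; exact h₂
  | cons d l ih => exact ⟨h₁.1, ih h₁.2⟩

theorem IsPath.reverse {l : List X.Dart} {v w : X.Vert} (h : IsPath v l w) :
    IsPath w (l.map rev).reverse v := by
  induction l generalizing v with
  | nil => exact Eq.symm h
  | cons d l ih =>
    rw [List.map_cons, List.reverse_cons]
    exact (ih h.2).append ⟨org_rev d, by rw [dst_rev]; exact h.1⟩

/-- Concatenation of edge paths. -/
def EdgePath.append {u v w : X.Vert} (a : X.EdgePath u v) (b : X.EdgePath v w) : X.EdgePath u w :=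
  ⟨a.1 ++ b.1, a.2.append b.2⟩

/-- The reversed edge path. -/
def EdgePath.reverse {v w : X.Vert} (a : X.EdgePath v w) : X.EdgePath w v :=
  ⟨(a.1.map rev).reverse, a.2.reverse⟩

/-- The trivial edge path. -/
def EdgePath.nil (v : X.Vert) : X.EdgePath v v := ⟨[], rfl⟩

theorem Step.append_right {l l' : List X.Dart} (h : Step l l') (m : List X.Dart) :
    Step (l ++ m) (l' ++ m) := by
  cases h with
  | backtrack l₁ l₂ d => simpa using Step.backtrack l₁ (l₂ ++ m) d
  | cell l₁ l₂ f => simpa using Step.cell l₁ (l₂ ++ m) f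

theorem Step.append_left {l l' : List X.Dart} (h : Step l l') (m : List X.Dart) :
    Step (m ++ l) (m ++ l') := by
  cases h with
  | backtrack l₁ l₂ d => simpa using Step.backtrack (m ++ l₁) l₂ d
  | cell l₁ l₂ f => simpa using Step.cell (m ++ l₁) l₂ f

theorem Flag.dart_flip (f : X.Flag) : f.flip.dart = rev f.dart := by
  rcases f with ⟨c, i, _ | _⟩ <;> simp [Flag.flip, Flag.dart]

theorem Flag.boundary_reverse (f : X.Flag) :
    (f.boundary.map rev).reverse = (Flag.next^[X.len f.1 - 1] f).flip.boundary := by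
  have hlen : X.len (Flag.next^[X.len f.1 - 1] f).flip.1 = X.len f.1 := by
    rw [Flag.next_iterate]; rfl
  apply List.ext_getElem
  · simp only [Flag.boundary, List.length_reverse, List.length_map, List.length_range, hlen]
  · intro k h₁ h₂
    have hk : k < X.len f.1 := by simpa [Flag.boundary] using h₁
    simp only [Flag.boundary, List.getElem_reverse, List.getElem_map, List.getElem_range,
      List.length_map, List.length_range]
    rw [← Flag.dart_flip]
    congr 1
    have e : X.len f.1 - 1 = (X.len f.1 - 1 - k) + k := by omega
    rw [Flag.next_iterate, Flag.next_iterate, Flag.next_iterate]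
    conv_rhs => rw [e]
    rcases f with ⟨c, i, _ | _⟩
    · simp only [Flag.flip, cond_false, Bool.not_false, cond_true, Nat.cast_add]
      congr 2
      have key : ∀ a b : ZMod (X.len c), i - a = i - (a + b) + b := fun a b => by ring
      exact key _ _
    · simp only [Flag.flip, cond_true, Bool.not_true, cond_false, Nat.cast_add]
      congr 2
      have key : ∀ a b : ZMod (X.len c), i + a = i + (a + b) - b := fun a b => by ring
      exact key _ _

theorem Step.reverse {l l' : List X.Dart} (h : Step l l') :
    Step (l.map rev).reverse (l'.map rev).reverse := by
  cases h with
  | backtrack l₁ l₂ d =>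
    simpa using Step.backtrack (l₂.map rev).reverse (l₁.map rev).reverse d
  | cell l₁ l₂ f =>
    have := Step.cell (l₂.map rev).reverse (l₁.map rev).reverse
      (Flag.next^[X.len f.1 - 1] f).flip
    rw [← Flag.boundary_reverse] at this
    simpa only [List.map_append, List.reverse_append, List.append_assoc] using this

theorem Homotopic.append_right {u v w : X.Vert} {a a' : X.EdgePath u v} (h : Homotopic a a')
    (b : X.EdgePath v w) : Homotopic (a.append b) (a'.append b) := by
  induction h with
  | rel _ _ h => exact .rel _ _ (h.append_right b.1)
  | refl _ => exact .refl _
  | symm _ _ _ ih => exact ih.symm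
  | trans _ _ _ _ _ ih₁ ih₂ => exact ih₁.trans _ _ _ ih₂

theorem Homotopic.append_left {u v w : X.Vert} {b b' : X.EdgePath v w} (h : Homotopic b b')
    (a : X.EdgePath u v) : Homotopic (a.append b) (a.append b') := by
  induction h with
  | rel _ _ h => exact .rel _ _ (h.append_left a.1)
  | refl _ => exact .refl _
  | symm _ _ _ ih => exact ih.symm
  | trans _ _ _ _ _ ih₁ ih₂ => exact ih₁.trans _ _ _ ih₂

theorem Homotopic.reverse {v w : X.Vert} {a a' : X.EdgePath v w} (h : Homotopic a a') :
    Homotopic a.reverse a'.reverse := by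
  induction h with
  | rel _ _ h => exact .rel _ _ h.reverse
  | refl _ => exact .refl _
  | symm _ _ _ ih => exact ih.symm
  | trans _ _ _ _ _ ih₁ ih₂ => exact ih₁.trans _ _ _ ih₂

theorem Homotopic.reverse_append {v w : X.Vert} (a : X.EdgePath v w) :
    Homotopic (a.reverse.append a) (EdgePath.nil w) := by
  obtain ⟨l, hl⟩ := a
  induction l generalizing v with
  | nil => cases hl; exact .refl _
  | cons d l ih =>
    refine Relation.EqvGen.trans _ _ _ (Relation.EqvGen.symm _ _ (.rel _ _ ?_)) (ih hl.2)
    have := Step.backtrack (l.map rev).reverse l (rev d)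
    simpa [EdgePath.append, EdgePath.reverse] using this

instance (x : X.Vert) : Group (X.FundGroup x) where
  mul := Quotient.map₂ EdgePath.append fun _ _ h₁ _ _ h₂ =>
    Relation.EqvGen.trans _ _ _ (Homotopic.append_right h₁ _) (Homotopic.append_left h₂ _)
  one := Quotient.mk _ (EdgePath.nil x)
  inv := Quotient.map EdgePath.reverse fun _ _ h => Homotopic.reverse h
  mul_assoc := by
    rintro ⟨a⟩ ⟨b⟩ ⟨c⟩
    exact congrArg (Quotient.mk (X.loopSetoid x)) (Subtype.ext (List.append_assoc _ _ _))
  one_mul := by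
    rintro ⟨a⟩
    exact congrArg (Quotient.mk (X.loopSetoid x)) (Subtype.ext (List.nil_append _))
  mul_one := by
    rintro ⟨a⟩
    exact congrArg (Quotient.mk (X.loopSetoid x)) (Subtype.ext (List.append_nil _))
  inv_mul_cancel := by
    rintro ⟨a⟩
    exact Quotient.sound (s := X.loopSetoid x) (Homotopic.reverse_append a)

end group

namespace Hom

variable {X Y : TwoComplex.{u}}

theorem isPath_map (f : Hom Y X) {l : List Y.Dart} {v w : Y.Vert} (h : IsPath v l w) :
    IsPath (f.onVert v) (l.map f.onDart) (f.onVert w) := by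
  induction l generalizing v with
  | nil => exact congrArg f.onVert h
  | cons d l ih =>
    refine ⟨by rw [f.map_org, h.1], ?_⟩
    rw [f.map_dst]
    exact ih h.2

theorem step_map (f : Hom Y X) {l l' : List Y.Dart} (h : Step l l') :
    Step (l.map f.onDart) (l'.map f.onDart) := by
  cases h with
  | backtrack l₁ l₂ d =>
    simpa [f.map_rev] using Step.backtrack (l₁.map f.onDart) (l₂.map f.onDart) (f.onDart d)
  | cell l₁ l₂ t =>
    simpa [f.map_boundary] using Step.cell (l₁.map f.onDart) (l₂.map f.onDart) (f.onFlag t)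

/-- The image of a closed edge path under a based map `f : (Y, y) → (X, x)`. -/
def mapLoop (f : Hom Y X) {y : Y.Vert} {x : X.Vert} (h : f.onVert y = x) (a : Y.EdgePath y y) :
    X.EdgePath x x :=
  ⟨a.1.map f.onDart, h ▸ f.isPath_map a.2⟩

/-- The homomorphism of fundamental groups induced by a based map `f : (Y, y) → (X, x)`. -/
def mapFundGroup (f : Hom Y X) {y : Y.Vert} {x : X.Vert} (h : f.onVert y = x) :
    Y.FundGroup y →* X.FundGroup x where
  toFun := Quotient.map (f.mapLoop h) fun a b hab => by
    change Homotopic _ _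
    change Homotopic _ _ at hab
    induction hab with
    | rel _ _ h => exact .rel _ _ (f.step_map h)
    | refl _ => exact .refl _
    | symm _ _ _ ih => exact ih.symm
    | trans _ _ _ _ _ ih₁ ih₂ => exact ih₁.trans _ _ _ ih₂
  map_one' := rfl
  map_mul' := by
    rintro ⟨a⟩ ⟨b⟩
    exact congrArg (Quotient.mk (X.loopSetoid x)) (Subtype.ext List.map_append)

/-- `f` is injective on fundamental groups, at every choice of base vertex. -/
def PiOneInjective (f : Hom Y X) : Prop :=
  ∀ y : Y.Vert, Function.Injective (f.mapFundGroup (rfl : f.onVert y = f.onVert y))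

end Hom

/-! ### Compactness, connectedness, subcomplexes -/

/-- A 2-complex is compact when it has finitely many cells. -/
def IsCompact (X : TwoComplex.{u}) : Prop := Finite X.Vert ∧ Finite X.Edge ∧ Finite X.Cell

/-- A 2-complex is connected when it is nonempty and any two vertices are joined by an edge path. -/
def IsConnected (X : TwoComplex.{u}) : Prop :=
  Nonempty X.Vert ∧ ∀ v w : X.Vert, Nonempty (X.EdgePath v w)

/-- A subcomplex: a set of cells that contains the boundary of each of its cells. -/
structure Subcomplex (X : TwoComplex.{u}) where
  verts : Set X.Vert
  edges : Set X.Edge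
  cells : Set X.Cell
  src_mem : ∀ e ∈ edges, X.src e ∈ verts
  tgt_mem : ∀ e ∈ edges, X.tgt e ∈ verts
  bd_mem : ∀ c ∈ cells, ∀ i : ZMod (X.len c), (X.bd c i).1 ∈ edges

namespace Subcomplex

variable {X : TwoComplex.{u}}

/-- Inclusion of subcomplexes. -/
instance : LE (Subcomplex X) where
  le A B := A.verts ⊆ B.verts ∧ A.edges ⊆ B.edges ∧ A.cells ⊆ B.cells

/-- A subcomplex, regarded as a 2-complex. -/
def toComplex (A : Subcomplex X) : TwoComplex.{u} where
  Vert := A.verts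
  Edge := A.edges
  Cell := A.cells
  src e := ⟨X.src e.1, A.src_mem e.1 e.2⟩
  tgt e := ⟨X.tgt e.1, A.tgt_mem e.1 e.2⟩
  len c := X.len c.1
  len_pos c := X.len_pos c.1
  bd c i := (⟨(X.bd c.1 i).1, A.bd_mem c.1 c.2 i⟩, (X.bd c.1 i).2)
  bd_closed c i := by
    have h := X.bd_closed c.1 i
    rcases h₁ : (X.bd c.1 i).2 <;> rcases h₂ : (X.bd c.1 (i + 1)).2 <;>
      simp_all
  bd_immersed c i h := by
    refine X.bd_immersed c.1 i (Prod.ext ?_ ?_)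
    · exact congrArg (fun d => d.1.1) h
    · exact congrArg (fun d => d.2) h

/-- The inclusion map of a subcomplex. -/
def incl (A : Subcomplex X) : Hom A.toComplex X where
  onVert v := v.1
  onDart d := (d.1.1, d.2)
  onFlag f := ⟨f.1.1, f.2⟩
  map_org := by rintro ⟨e, _ | _⟩ <;> rfl
  map_rev _ := rfl
  map_dart := by rintro ⟨c, i, _ | _⟩ <;> rfl
  map_next _ := rfl
  map_flip _ := rfl
  map_len _ := rfl

end Subcomplex

/-! ### Weights and perimeter -/

/-- The weights of a weighted 2-complex: each side of `X` has a nonnegative integer weight, the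
perimeter of each edge (the sum of the weights of the sides present at it) is finite, and the weight
of each 2-cell (the sum of the weights of its sides) is positive. -/
structure Weighting (X : TwoComplex.{u}) where
  wt : X.Side → ℕ
  finite_at_edge : ∀ e : X.Edge, {s : X.Side | s.edge = e ∧ wt s ≠ 0}.Finite
  cell_pos : ∀ c : X.Cell, 0 < ∑ᶠ i : ZMod (X.len c), wt ⟨c, i⟩

/-- The sides of `X` that are missing at the edge `y` of `Y`: they are present at the image of `y`,
but are not the image of a side of `Y` that is present at `y`. -/
def Hom.missing {X Y : TwoComplex.{u}} (φ : Hom Y X) (y : Y.Edge) : Set X.Side :=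
  {s | s.edge = φ.onEdge y ∧ ¬ ∃ t : Y.Side, t.edge = y ∧ φ.onSide t = s}

/-- The weighted perimeter of a map `φ : Y → X`, for compact `Y`: the sum, over the edges `y` of
`Y`, of the weights of the sides of `X` missing at `y`. Both sums have finite support. -/
noncomputable def Weighting.perimeter {X Y : TwoComplex.{u}} (W : X.Weighting) (φ : Hom Y X) : ℕ :=
  ∑ᶠ y : Y.Edge, ∑ᶠ s ∈ φ.missing y, W.wt s

/-- The perimeter reduction hypothesis for a weighted 2-complex. -/
def Weighting.PerimeterReductionHypothesis {X : TwoComplex.{u}} (W : X.Weighting) : Prop :=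
  ∀ (Y : TwoComplex.{u}) (φ : Hom Y X) (y : Y.Vert) (x : X.Vert) (hφ : φ.onVert y = x),
    Y.IsCompact → Y.IsConnected → φ.IsOneImmersion → ¬ φ.PiOneInjective →
    ∃ (Y' : TwoComplex.{u}) (ι : Hom Y Y') (φ' : Hom Y' X) (y' : Y'.Vert)
      (_ : ι.onVert y = y') (hφ' : φ'.onVert y' = x),
      φ'.comp ι = φ ∧ Y'.IsCompact ∧ Y'.IsConnected ∧
      W.perimeter φ' < W.perimeter φ ∧
      (φ'.mapFundGroup hφ').range = (φ.mapFundGroup hφ).range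

end TwoComplex

/-- A group is coherent if all its finitely generated subgroups are finitely presented. -/
def IsCoherentGroup (G : Type*) [Group G] : Prop :=
  ∀ H : Subgroup G, H.FG → Group.IsFinitelyPresented H

namespace TwoComplex

variable {X Y Z : TwoComplex.{u}}

/-! Perimeters of compact complexes are natural numbers, so among the compact connected subcomplexes
of a connected cover that contain a given compact $C$, one has minimal perimeter as soon as any
exist. They do: join the vertices of $C$ to a base vertex by finitely many paths
(`exists_connected_le`). This is (B).

For (A), the composite $Y\to\widehat X\to X$ is a 1-immersion that is not $\pi_1$-injective, so the
hypothesis gives $\phi^+\colon Y^+\to X$ of smaller perimeter with the same image on $\pi_1$. That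
equality is exactly what the lifting criterion needs (`exists_lift_hom`), so $\phi^+$ lifts to
$\widehat X$. By uniqueness of lifts (`lift_hom_unique`) the lift extends the inclusion of $Y$,
hence its image contains $Y$. Replacing $Y^+$ by this image does not raise the perimeter
(`perimeter_image_le`).

For coherence, pass to the cover with group $H$ (`exists_covering_of_subgroup`) and let $C$ be the
union of loops representing finitely many generators. A subcomplex of minimal perimeter containing
$C$ is $\pi_1$-injective by (A), and it carries all generators, so $H$ is the fundamental group of a
compact connected complex. Such a group is finitely presented (`isFinitelyPresented_fundGroup`). -/

theorem rev_inj {d d' : X.Dart} : rev d = rev d' ↔ d = d' :=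
  ⟨fun h => by rw [← rev_rev d, h, rev_rev], fun h => by rw [h]⟩

/-! ### Edge paths -/

theorem IsPath.target_unique {l : List X.Dart} {v w w' : X.Vert} (h : IsPath v l w)
    (h' : IsPath v l w') : w = w' := by
  induction l generalizing v with
  | nil => exact Eq.trans (Eq.symm h) h'
  | cons d l ih => exact ih h.2 h'.2

theorem isPath_append {l₁ l₂ : List X.Dart} {u w : X.Vert} :
    IsPath u (l₁ ++ l₂) w ↔ ∃ v, IsPath u l₁ v ∧ IsPath v l₂ w := by
  refine ⟨fun h => ?_, fun ⟨v, h₁, h₂⟩ => h₁.append h₂⟩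
  induction l₁ generalizing u with
  | nil => exact ⟨u, rfl, h⟩
  | cons d l ih =>
    obtain ⟨v, h₁, h₂⟩ := ih h.2
    exact ⟨v, ⟨h.1, h₁⟩, h₂⟩

theorem isPath_singleton (d : X.Dart) : IsPath (org d) [d] (dst d) := ⟨rfl, rfl⟩

theorem org_dart_next (f : X.Flag) : org f.next.dart = dst f.dart := by
  rcases f with ⟨c, i, _ | _⟩
  · have h := X.bd_closed c (i - 1)
    rw [sub_add_cancel] at h
    simp only [Flag.next, Flag.dart, cond_false, org_rev, dst_rev]
    exact h
  · exact (X.bd_closed c i).symm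

theorem isPath_range_next (f : X.Flag) (k : ℕ) :
    IsPath (org f.dart) ((List.range k).map fun k => (Flag.next^[k] f).dart)
      (org (Flag.next^[k] f).dart) := by
  induction k with
  | zero => rfl
  | succ k ih =>
    rw [List.range_succ, List.map_append]
    refine ih.append ?_
    rw [Function.iterate_succ_apply', org_dart_next]
    exact isPath_singleton _

theorem isPath_boundary (f : X.Flag) : IsPath (org f.dart) f.boundary (org f.dart) := by
  have h := isPath_range_next f (X.len f.1)
  have e : Flag.next^[X.len f.1] f = f := by
    rw [Flag.next_iterate]
    rcases f with ⟨c, i, _ | _⟩ <;> simp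
  rwa [e] at h

/-- Since polygons have at least one side, a boundary path determines its base vertex; this locates
the lift of an inserted 2-cell. -/
theorem boundary_eq_cons (f : X.Flag) : ∃ l, f.boundary = f.dart :: l := by
  obtain ⟨n, hn⟩ := Nat.exists_eq_succ_of_ne_zero (X.len_pos f.1).ne'
  exact ⟨_, by rw [Flag.boundary, hn, List.range_succ_eq_map]; rfl⟩

theorem IsPath.org_eq_of_boundary {f : X.Flag} {l : List X.Dart} {v w : X.Vert}
    (h : IsPath v (f.boundary ++ l) w) : org f.dart = v := by
  obtain ⟨m, hm⟩ := boundary_eq_cons f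
  rw [hm] at h
  exact h.1

theorem Homotopic.append_reverse {v w : X.Vert} (a : X.EdgePath v w) :
    Homotopic (a.append a.reverse) (EdgePath.nil v) := by
  have h := Homotopic.reverse_append a.reverse
  have e : a.reverse.reverse = a := by
    apply Subtype.ext
    simp [EdgePath.reverse, List.map_reverse, Function.comp_def]
  rwa [e] at h

/-! ### Elements of the fundamental group -/

/-- The class of a closed edge path. -/
def FundGroup.mk {x : X.Vert} (l : List X.Dart) (h : IsPath x l x) : X.FundGroup x :=
  Quotient.mk (X.loopSetoid x) ⟨l, h⟩

namespace FundGroup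

theorem mk_surjective {x : X.Vert} (g : X.FundGroup x) : ∃ l h, g = mk l h := by
  obtain ⟨a⟩ := g
  exact ⟨a.1, a.2, rfl⟩

theorem mk_eq_mk {x : X.Vert} {l l' : List X.Dart} {h : IsPath x l x} {h' : IsPath x l' x} :
    mk l h = mk l' h' ↔ Homotopic (⟨l, h⟩ : X.EdgePath x x) ⟨l', h'⟩ :=
  Quotient.eq (r := X.loopSetoid x)

theorem mk_mul_mk {x : X.Vert} {l l' : List X.Dart} (h : IsPath x l x) (h' : IsPath x l' x) :
    mk l h * mk l' h' = mk (l ++ l') (h.append h') := rfl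

theorem mk_inv {x : X.Vert} {l : List X.Dart} (h : IsPath x l x) :
    (mk l h)⁻¹ = mk (l.map rev).reverse h.reverse := rfl

end FundGroup

theorem Hom.mapFundGroup_mk (f : Hom Y X) {y : Y.Vert} {x : X.Vert} (h : f.onVert y = x)
    {l : List Y.Dart} (hl : IsPath y l y) :
    f.mapFundGroup h (FundGroup.mk l hl) = FundGroup.mk (l.map f.onDart) (h ▸ f.isPath_map hl) :=
  rfl

theorem Hom.mapFundGroup_comp (g : Hom Y X) (f : Hom Z Y) {z : Z.Vert} {y : Y.Vert} {x : X.Vert}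
    (hf : f.onVert z = y) (hg : g.onVert y = x) (h : (g.comp f).onVert z = x) (a : Z.FundGroup z) :
    (g.comp f).mapFundGroup h a = g.mapFundGroup hg (f.mapFundGroup hf a) := by
  obtain ⟨l, hl, rfl⟩ := FundGroup.mk_surjective a
  simp only [Hom.mapFundGroup_mk]
  congr 1
  simp [Hom.comp]

/-! ### Lifting paths and homotopies to coverings -/

/-- At each vertex local injectivity leaves one choice for the next oriented edge. -/
theorem Hom.isPath_lift_unique {p : Hom Y X} (hp : p.IsOneImmersion) {l m : List Y.Dart}
    {v w w' : Y.Vert} (hl : IsPath v l w) (hm : IsPath v m w')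
    (h : l.map p.onDart = m.map p.onDart) : l = m := by
  induction l generalizing v m with
  | nil => simpa using h.symm
  | cons d l ih =>
    cases m with
    | nil => simp at h
    | cons e m =>
      simp only [List.map_cons, List.cons.injEq] at h
      obtain rfl : d = e := hp v hl.1 hm.1 h.1
      rw [ih hl.2 hm.2 h.2]

theorem Hom.target_lift_unique {p : Hom Y X} (hp : p.IsOneImmersion) {l m : List Y.Dart}
    {v w w' : Y.Vert} (hl : IsPath v l w) (hm : IsPath v m w')
    (h : l.map p.onDart = m.map p.onDart) : w = w' := by
  obtain rfl := p.isPath_lift_unique hp hl hm h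
  exact hl.target_unique hm

namespace Hom.IsCovering

variable {p : Hom Y X} (hp : p.IsCovering)
include hp

theorem isOneImmersion : p.IsOneImmersion := fun v => (hp.bijOn_darts v).injOn

theorem exists_dart {v : Y.Vert} {d : X.Dart} (h : org d = p.onVert v) :
    ∃ d' : Y.Dart, org d' = v ∧ p.onDart d' = d :=
  (hp.bijOn_darts v).surjOn h

theorem dart_unique {d d' : Y.Dart} (h : org d = org d') (h' : p.onDart d = p.onDart d') :
    d = d' :=
  hp.isOneImmersion (org d') h rfl h'

theorem exists_flag {d : Y.Dart} {f : X.Flag} (h : f.dart = p.onDart d) :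
    ∃ f' : Y.Flag, f'.dart = d ∧ p.onFlag f' = f :=
  (hp.bijOn_flags d).surjOn h

theorem flag_unique {f f' : Y.Flag} (h : f.dart = f'.dart) (h' : p.onFlag f = p.onFlag f') :
    f = f' :=
  (hp.bijOn_flags f'.dart).injOn h rfl h'

theorem exists_lift {l : List X.Dart} {v : Y.Vert} {w : X.Vert} (h : IsPath (p.onVert v) l w) :
    ∃ (m : List Y.Dart) (w' : Y.Vert), IsPath v m w' ∧ m.map p.onDart = l ∧ p.onVert w' = w := by
  induction l generalizing v with
  | nil => exact ⟨[], v, rfl, rfl, h⟩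
  | cons d l ih =>
    obtain ⟨d', rfl, rfl⟩ := hp.exists_dart h.1
    have h2 := h.2
    rw [p.map_dst] at h2
    obtain ⟨m, w', hm, rfl, hw⟩ := ih h2
    exact ⟨d' :: m, w', ⟨rfl, hm⟩, rfl, hw⟩

/-- Two paths of which the second is obtained from the first by an elementary homotopy have lifts
with the same property. -/
theorem lift_step {l l' : List X.Dart} (h : Step l l') {v w : Y.Vert} {w₀ : X.Vert}
    {m : List Y.Dart} (hm : IsPath v m w) (hml : m.map p.onDart = l)
    (hl' : IsPath (p.onVert v) l' w₀) :
    ∃ m', IsPath v m' w ∧ m'.map p.onDart = l' ∧ Step m m' := by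
  cases h with
  | backtrack l₁ l₂ d =>
    obtain ⟨m₁, m₂, rfl, rfl, rfl⟩ := List.map_eq_append_iff.1 hml
    obtain ⟨u, hu₁, hu₂⟩ := isPath_append.1 hm
    rw [List.append_assoc] at hl'
    obtain ⟨u', hu', hd⟩ := isPath_append.1 hl'
    obtain rfl := (p.isPath_map hu₁).target_unique hu'
    obtain ⟨d, rfl, rfl⟩ := hp.exists_dart hd.1
    have hb : IsPath (org d) [d, rev d] (org d) := ⟨rfl, org_rev d, dst_rev d⟩
    refine ⟨m₁ ++ [d, rev d] ++ m₂, (hu₁.append hb).append hu₂, ?_, .backtrack _ _ _⟩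
    simp [p.map_rev]
  | cell l₁ l₂ f =>
    obtain ⟨m₁, m₂, rfl, rfl, rfl⟩ := List.map_eq_append_iff.1 hml
    obtain ⟨u, hu₁, hu₂⟩ := isPath_append.1 hm
    rw [List.append_assoc] at hl'
    obtain ⟨u', hu', hd⟩ := isPath_append.1 hl'
    obtain rfl := (p.isPath_map hu₁).target_unique hu'
    obtain ⟨d, rfl, hdf⟩ := hp.exists_dart hd.org_eq_of_boundary
    obtain ⟨f, rfl, rfl⟩ := hp.exists_flag hdf.symm
    refine ⟨m₁ ++ f.boundary ++ m₂, (hu₁.append (isPath_boundary f)).append hu₂, ?_, .cell _ _ _⟩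
    simp [p.map_boundary]

/-- Deletions lift as well as insertions: the segment above the deleted backtrack or boundary has
the same projection and start as a closed lift, so by unique path lifting it is that closed lift and
can be cut out. -/
theorem unlift_step {l l' : List X.Dart} (h : Step l' l) {v w : Y.Vert}
    {m : List Y.Dart} (hm : IsPath v m w) (hml : m.map p.onDart = l) :
    ∃ m', IsPath v m' w ∧ m'.map p.onDart = l' ∧ Step m' m := by
  cases h with
  | backtrack l₁ l₂ d =>
    obtain ⟨m₁₂, m₃, rfl, h₁₂, rfl⟩ := List.map_eq_append_iff.1 hml
    obtain ⟨m₁, m₂, rfl, rfl, h₂⟩ := List.map_eq_append_iff.1 h₁₂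
    obtain ⟨u₂, hu₁₂, hu₃⟩ := isPath_append.1 hm
    obtain ⟨u₁, hu₁, hu₂⟩ := isPath_append.1 hu₁₂
    obtain ⟨e, m₂, rfl, rfl, h₂⟩ := List.map_eq_cons_iff.1 h₂
    have key : IsPath u₁ [e, rev e] u₁ := ⟨hu₂.1, org_rev e, by rw [dst_rev]; exact hu₂.1⟩
    have e₂ := p.isPath_lift_unique hp.isOneImmersion hu₂ key (by simp [h₂, p.map_rev])
    rw [e₂] at hu₂ ⊢
    obtain rfl := hu₂.target_unique key
    exact ⟨m₁ ++ m₃, hu₁.append hu₃, by simp, .backtrack _ _ _⟩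
  | cell l₁ l₂ f =>
    obtain ⟨m₁₂, m₃, rfl, h₁₂, rfl⟩ := List.map_eq_append_iff.1 hml
    obtain ⟨m₁, m₂, rfl, rfl, h₂⟩ := List.map_eq_append_iff.1 h₁₂
    obtain ⟨u₂, hu₁₂, hu₃⟩ := isPath_append.1 hm
    obtain ⟨u₁, hu₁, hu₂⟩ := isPath_append.1 hu₁₂
    have hb : IsPath (p.onVert u₁) (f.boundary ++ []) (p.onVert u₂) := by
      rw [List.append_nil, ← h₂]; exact p.isPath_map hu₂
    obtain ⟨d, rfl, hdf⟩ := hp.exists_dart hb.org_eq_of_boundary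
    obtain ⟨f, rfl, rfl⟩ := hp.exists_flag hdf.symm
    have e₂ := p.isPath_lift_unique hp.isOneImmersion hu₂ (isPath_boundary f)
      (by rw [h₂, p.map_boundary])
    rw [e₂] at hu₂ ⊢
    obtain rfl := hu₂.target_unique (isPath_boundary f)
    exact ⟨m₁ ++ m₃, hu₁.append hu₃, by simp, .cell _ _ _⟩

/-- Both directions are carried together so that the symmetry case of the generated equivalence
relation merely swaps them. -/
theorem lift_homotopic {v : Y.Vert} {w₀ : X.Vert} {a b : X.EdgePath (p.onVert v) w₀}
    (h : Homotopic a b) :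
    (∀ (w : Y.Vert) (a' : Y.EdgePath v w), a'.1.map p.onDart = a.1 →
      ∃ b' : Y.EdgePath v w, b'.1.map p.onDart = b.1 ∧ Homotopic a' b') ∧
    (∀ (w : Y.Vert) (b' : Y.EdgePath v w), b'.1.map p.onDart = b.1 →
      ∃ a' : Y.EdgePath v w, a'.1.map p.onDart = a.1 ∧ Homotopic b' a') := by
  induction h with
  | rel a b h =>
    refine ⟨fun w a' ha' => ?_, fun w b' hb' => ?_⟩
    · obtain ⟨m, hm, e, hs⟩ := hp.lift_step h a'.2 ha' b.2
      exact ⟨⟨m, hm⟩, e, .rel _ _ hs⟩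
    · obtain ⟨m, hm, e, hs⟩ := hp.unlift_step h b'.2 hb'
      exact ⟨⟨m, hm⟩, e, .symm _ _ (.rel _ _ hs)⟩
  | refl a => exact ⟨fun w a' h => ⟨a', h, .refl _⟩, fun w a' h => ⟨a', h, .refl _⟩⟩
  | symm _ _ _ ih => exact ih.symm
  | trans _ _ _ _ _ ih₁ ih₂ =>
    refine ⟨fun w a' ha' => ?_, fun w c' hc' => ?_⟩
    · obtain ⟨b', hb', h₁⟩ := ih₁.1 w a' ha'
      obtain ⟨c', hc', h₂⟩ := ih₂.1 w b' hb'
      exact ⟨c', hc', h₁.trans _ _ _ h₂⟩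
    · obtain ⟨b', hb', h₁⟩ := ih₂.2 w c' hc'
      obtain ⟨a', ha', h₂⟩ := ih₁.2 w b' hb'
      exact ⟨a', ha', h₁.trans _ _ _ h₂⟩

/-- A homotopy downstairs lifts to one starting at the first loop; its final path lifts the image of
the second loop, hence equals it. -/
theorem piOneInjective : p.PiOneInjective := by
  intro y a b hab
  obtain ⟨l, hl, rfl⟩ := FundGroup.mk_surjective a
  obtain ⟨m, hm, rfl⟩ := FundGroup.mk_surjective b
  rw [Hom.mapFundGroup_mk, Hom.mapFundGroup_mk, FundGroup.mk_eq_mk] at hab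
  obtain ⟨b', hb', h⟩ := (hp.lift_homotopic hab).1 y ⟨l, hl⟩ rfl
  obtain rfl : b' = ⟨m, hm⟩ :=
    Subtype.ext (p.isPath_lift_unique hp.isOneImmersion b'.2 hm hb')
  exact FundGroup.mk_eq_mk.2 h

/-- A closed path lifts to a closed path if it represents an element of the image of the
fundamental group of the covering. -/
theorem exists_closed_lift {v : Y.Vert} {x : X.Vert} (hv : p.onVert v = x) {l : List X.Dart}
    (hl : IsPath x l x) (h : FundGroup.mk l hl ∈ (p.mapFundGroup hv).range) :
    ∃ m, IsPath v m v ∧ m.map p.onDart = l := by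
  subst hv
  obtain ⟨a, ha⟩ := h
  obtain ⟨m, hm, rfl⟩ := FundGroup.mk_surjective a
  rw [Hom.mapFundGroup_mk, FundGroup.mk_eq_mk] at ha
  obtain ⟨b, hb, -⟩ := (hp.lift_homotopic ha).1 v ⟨m, hm⟩ rfl
  exact ⟨b.1, b.2, hb⟩

end Hom.IsCovering

/-- The lifting criterion: a map `φ` from a connected complex lifts to a covering `p` when `φ` maps
closed paths to paths with closed lifts. -/
theorem Hom.IsCovering.exists_lift_hom {p : Hom Y X} (hp : p.IsCovering) (φ : Hom Z X)
    (hZ : Z.IsConnected) {z : Z.Vert} {y : Y.Vert} (hzy : p.onVert y = φ.onVert z)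
    (h : ∀ l, IsPath z l z → ∃ m, IsPath y m y ∧ m.map p.onDart = l.map φ.onDart) :
    ∃ ψ : Hom Z Y, p.comp ψ = φ ∧ ψ.onVert z = y := by
  have hV : ∀ w : Z.Vert, ∃ w' : Y.Vert, p.onVert w' = φ.onVert w ∧
      ∀ l, IsPath z l w → ∃ m, IsPath y m w' ∧ m.map p.onDart = l.map φ.onDart := by
    intro w
    obtain ⟨a⟩ := hZ.2 z w
    obtain ⟨m, w', hm, hma, hw⟩ := hp.exists_lift (hzy ▸ φ.isPath_map a.2)
    refine ⟨w', hw, fun l hl => ?_⟩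
    obtain ⟨m₂, w₂, hm₂, hml, hw₂⟩ := hp.exists_lift (v := y) (hzy ▸ φ.isPath_map hl)
    -- The endpoint does not depend on the path: the loop `l` followed by the reverse of `a` has a
    -- closed lift, whose first part is the lift of `l` and whose second part, reversed, is the lift
    -- of `a`. Both lifts therefore end at the break point `u`.
    obtain ⟨n, hn, hnl⟩ := h _ (hl.append a.2.reverse)
    obtain ⟨n₁, n₂, rfl, h₁, h₂⟩ := List.map_eq_append_iff.1 (hnl.trans List.map_append)
    obtain ⟨u, hu, hu₂⟩ := isPath_append.1 hn
    obtain rfl := p.target_lift_unique hp.isOneImmersion hu hm₂ (h₁.trans hml.symm)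
    obtain rfl := p.target_lift_unique hp.isOneImmersion hm hu₂.reverse (by
      rw [hma, List.map_reverse, List.map_map]
      have : p.onDart ∘ rev = rev ∘ p.onDart := funext p.map_rev
      have h' : φ.onDart ∘ rev = rev ∘ φ.onDart := funext φ.map_rev
      rw [this, ← List.map_map, h₂, List.map_reverse, List.map_reverse, List.reverse_reverse,
        List.map_map, List.map_map, Function.comp_assoc, h', ← Function.comp_assoc]
      simp [Function.comp_def])
    exact ⟨m₂, hm₂, hml⟩
  choose V hpV hVl using hV
  have hD : ∀ d : Z.Dart, ∃ d' : Y.Dart, org d' = V (org d) ∧ p.onDart d' = φ.onDart d :=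
    fun d => hp.exists_dart (by rw [φ.map_org, hpV])
  choose D hDo hpD using hD
  have hDd : ∀ d, dst (D d) = V (dst d) := by
    intro d
    obtain ⟨a⟩ := hZ.2 z (org d)
    -- Compare the lift of `a` extended by `D d` with the lift of `a` followed by `d`.
    obtain ⟨m, hm, hma⟩ := hVl _ _ a.2
    obtain ⟨m', hm', hma'⟩ := hVl _ _ (a.2.append (isPath_singleton d))
    refine p.target_lift_unique hp.isOneImmersion
      (hm.append (l₂ := [D d]) ⟨hDo d, rfl⟩) hm' ?_
    simp [hma, hma', hpD]
  have hF : ∀ f : Z.Flag, ∃ f' : Y.Flag, f'.dart = D f.dart ∧ p.onFlag f' = φ.onFlag f :=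
    fun f => hp.exists_flag (by rw [φ.map_dart, hpD])
  choose F hFd hpF using hF
  have hDr : ∀ d, D (rev d) = rev (D d) := fun d =>
    hp.dart_unique (by rw [hDo, org_rev, org_rev, hDd]) (by rw [hpD, φ.map_rev, p.map_rev, hpD])
  refine ⟨⟨V, D, F, hDo, hDr, hFd, fun f => ?_, fun f => ?_, fun f => ?_⟩, ?_, ?_⟩
  · refine hp.flag_unique ?_ (by rw [hpF, φ.map_next, p.map_next, hpF])
    refine (hFd _).trans (hp.dart_unique ?_ ?_)
    · rw [hDo, org_dart_next, org_dart_next, hFd, hDd]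
    · rw [hpD, ← φ.map_dart, φ.map_next, ← p.map_dart, p.map_next, hpF]
  · refine hp.flag_unique ?_ (by rw [hpF, φ.map_flip, p.map_flip, hpF])
    rw [hFd, Flag.dart_flip, Flag.dart_flip, hFd, hDr]
  · rw [← p.map_len, hpF, φ.map_len]
  · exact Hom.ext (funext hpV) (funext hpD) (funext hpF)
  -- The empty path at `z` lifts only to the empty path at `y`.
  · obtain ⟨m, hm, hm'⟩ := hVl z [] rfl
    obtain rfl : m = [] := by simpa using hm'
    exact Eq.symm hm

/-- Lifts of a map from a connected complex to a covering which agree at a vertex are equal. -/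
theorem Hom.IsCovering.lift_hom_unique {p : Hom Y X} (hp : p.IsCovering) {φ ψ : Hom Z Y}
    (hZ : Z.IsConnected) {z : Z.Vert} (hz : φ.onVert z = ψ.onVert z)
    (h : p.comp φ = p.comp ψ) : φ = ψ := by
  have hd : ∀ d, p.onDart (φ.onDart d) = p.onDart (ψ.onDart d) := congrFun (congrArg onDart h)
  have hf : ∀ f, p.onFlag (φ.onFlag f) = p.onFlag (ψ.onFlag f) := congrFun (congrArg onFlag h)
  have hV : ∀ w, φ.onVert w = ψ.onVert w := by
    intro w
    obtain ⟨a⟩ := hZ.2 z w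
    exact p.target_lift_unique hp.isOneImmersion (φ.isPath_map a.2)
      (hz ▸ ψ.isPath_map a.2) (by simp [hd])
  have hD : ∀ d, φ.onDart d = ψ.onDart d := fun d =>
    hp.dart_unique (by rw [φ.map_org, ψ.map_org, hV]) (hd d)
  exact Hom.ext (funext hV) (funext hD) (funext fun f =>
    hp.flag_unique (by rw [φ.map_dart, ψ.map_dart, hD]) (hf f))


/-! ### Coverings from actions of edge paths -/

/-- An action of the edge paths of `X`, up to homotopy, on a set fibred over the vertices of `X`:
the data of a covering of `X`. -/
structure PathAction (X : TwoComplex.{u}) where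
  Pt : Type u
  proj : Pt → X.Vert
  act : Pt → X.Dart → Pt
  proj_act : ∀ P d, org d = proj P → proj (act P d) = dst d
  act_rev : ∀ P d, org d = proj P → act (act P d) (rev d) = P
  act_boundary : ∀ P (f : X.Flag), org f.dart = proj P → f.boundary.foldl act P = P

namespace PathAction

variable (A : PathAction X)

/-- The edges of the covering defined by a path action. -/
def TotalEdge : Type u := {q : A.Pt × X.Edge // X.src q.2 = A.proj q.1}

/-- The initial vertex of an oriented edge of the covering. -/
def totalOrg (d : A.TotalEdge × Bool) : A.Pt :=
  bif d.2 then d.1.1.1 else A.act d.1.1.1 (d.1.1.2, true)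

/-- The terminal vertex of an oriented edge of the covering. -/
def totalDst (d : A.TotalEdge × Bool) : A.Pt :=
  bif d.2 then A.act d.1.1.1 (d.1.1.2, true) else d.1.1.1

/-- The oriented edge of `X` below an oriented edge of the covering. -/
def projDart (d : A.TotalEdge × Bool) : X.Dart := (d.1.1.2, d.2)

theorem org_projDart (d : A.TotalEdge × Bool) : org (A.projDart d) = A.proj (A.totalOrg d) := by
  obtain ⟨⟨⟨P, e⟩, h⟩, _ | _⟩ := d
  · exact (A.proj_act P (e, true) h).symm
  · exact h

theorem act_projDart (d : A.TotalEdge × Bool) :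
    A.act (A.totalOrg d) (A.projDart d) = A.totalDst d := by
  obtain ⟨⟨⟨P, e⟩, h⟩, _ | _⟩ := d
  · exact A.act_rev P (e, true) h
  · rfl

theorem exists_totalEdge {P : A.Pt} {d : X.Dart} (h : org d = A.proj P) :
    ∃ d', A.totalOrg d' = P ∧ A.projDart d' = d := by
  obtain ⟨e, _ | _⟩ := d
  -- A total edge stores the point above the source of `e`; when `e` is traversed backwards from
  -- `P`, that point is where the traversal ends.
  · refine ⟨(⟨(A.act P (e, false), e), ?_⟩, false), A.act_rev P (e, false) h, rfl⟩
    exact (A.proj_act P (e, false) h).symm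
  · exact ⟨(⟨(P, e), h⟩, true), rfl, rfl⟩

theorem totalEdge_ext {d d' : A.TotalEdge × Bool} (h : A.totalOrg d = A.totalOrg d')
    (h' : A.projDart d = A.projDart d') : d = d' := by
  -- For a negatively oriented edge the stored point is the terminal one, so both ends must be
  -- compared.
  have h₂ : A.totalDst d = A.totalDst d' := by rw [← act_projDart, ← act_projDart, h, h']
  obtain ⟨⟨⟨P, e⟩, hP⟩, b⟩ := d
  obtain ⟨⟨⟨P', e'⟩, hP'⟩, b'⟩ := d'
  obtain ⟨rfl, rfl⟩ : e = e' ∧ b = b' := Prod.mk.inj h'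
  cases b
  · obtain rfl : P = P' := h₂
    rfl
  · obtain rfl : P = P' := h
    rfl

/-- The lift of an oriented edge of `X` to the covering. -/
noncomputable def liftDart {P : A.Pt} {d : X.Dart} (h : org d = A.proj P) : A.TotalEdge × Bool :=
  (A.exists_totalEdge h).choose

theorem totalOrg_liftDart {P : A.Pt} {d : X.Dart} (h : org d = A.proj P) :
    A.totalOrg (A.liftDart h) = P := (A.exists_totalEdge h).choose_spec.1

theorem projDart_liftDart {P : A.Pt} {d : X.Dart} (h : org d = A.proj P) :
    A.projDart (A.liftDart h) = d := (A.exists_totalEdge h).choose_spec.2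

theorem totalDst_liftDart {P : A.Pt} {d : X.Dart} (h : org d = A.proj P) :
    A.totalDst (A.liftDart h) = A.act P d := by
  rw [← act_projDart, totalOrg_liftDart, projDart_liftDart]

/-- The 2-cells of the covering: lifts of polygons. -/
def TotalCell : Type u :=
  {q : Σ c : X.Cell, (ZMod (X.len c) → A.Pt) //
    ∀ i, org (X.bd q.1 i) = A.proj (q.2 i) ∧ A.act (q.2 i) (X.bd q.1 i) = q.2 (i + 1)}

/-- The covering defined by a path action. -/
noncomputable def total : TwoComplex.{u} where
  Vert := A.Pt
  Edge := A.TotalEdge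
  Cell := A.TotalCell
  src e := A.totalOrg (e, true)
  tgt e := A.totalDst (e, true)
  len q := X.len q.1.1
  len_pos q := X.len_pos q.1.1
  bd q i := A.liftDart (q.2 i).1
  bd_closed q i := by
    refine Eq.trans (b := A.totalDst (A.liftDart (q.2 i).1)) ?_
      (Eq.trans (b := A.totalOrg (A.liftDart (q.2 (i + 1)).1)) ?_ ?_)
    · rfl
    · rw [totalDst_liftDart, totalOrg_liftDart]
      exact (q.2 i).2
    · rfl
  bd_immersed q i h := by
    refine X.bd_immersed q.1.1 i ?_
    have h₁ := A.projDart_liftDart (q.2 i).1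
    have h₂ := A.projDart_liftDart (q.2 (i + 1)).1
    exact h₂.symm.trans ((congrArg A.projDart h).trans (congrArg rev h₁))

/-- The projection of the covering defined by a path action. -/
noncomputable def projHom : Hom A.total X where
  onVert := A.proj
  onDart := A.projDart
  onFlag f := ⟨f.1.1.1, f.2⟩
  map_org := A.org_projDart
  map_rev _ := rfl
  map_dart := by
    rintro ⟨q, i, _ | _⟩
    · exact congrArg rev (A.projDart_liftDart (q.2 i).1).symm
    · exact (A.projDart_liftDart (q.2 i).1).symm
  map_next _ := rfl
  map_flip _ := rfl
  map_len _ := rfl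

/-- The corners of the lifted polygon are found by acting on the origin of `d` along the boundary of
`c`, starting at side `i`. The axiom `act_boundary` makes this walk close up. -/
theorem exists_flag_of_positive {c : X.Cell} {i : ZMod (X.len c)} {d : A.total.Dart}
    (h : X.bd c i = A.projDart d) :
    ∃ f : A.total.Flag, f.dart = d ∧ A.projHom.onFlag f = ⟨c, i, true⟩ := by
  have : NeZero (X.len c) := ⟨(X.len_pos c).ne'⟩
  let f : X.Flag := ⟨c, i, true⟩
  let P := A.totalOrg d
  let G : ℕ → A.Pt := fun k =>
    ((List.range k).map fun k => (Flag.next^[k] f).dart).foldl A.act P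
  have hf : ∀ k, (Flag.next^[k] f).dart = X.bd c (i + k) := by
    intro k
    rw [Flag.next_iterate]
    rfl
  have hP : org f.dart = A.proj P := by
    rw [← A.org_projDart d, ← h]; rfl
  have hG : ∀ k, G (k + 1) = A.act (G k) (X.bd c (i + k)) := by
    intro k
    simp only [G]
    rw [List.range_succ, List.map_append, List.foldl_append, ← hf]
    rfl
  have hGp : ∀ k : ℕ, org (X.bd c (i + k)) = A.proj (G k) := by
    intro k
    induction k with
    | zero => simpa [G, f, Flag.dart] using hP
    | succ k ih =>
      rw [hG, A.proj_act _ _ ih, ← hf, ← hf, Function.iterate_succ_apply', org_dart_next]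
  have hGl : G (X.len c) = P := A.act_boundary P f hP
  have hcast : ∀ j : ZMod (X.len c), i + ((j - i).val : ℕ) = j := fun j => by
    rw [ZMod.natCast_zmod_val, add_sub_cancel]
  -- The walk `G` on natural numbers descends to the cyclic indices: the only nontrivial case is the
  -- wrap-around after `len c` steps, where `hGl` returns to `P`.
  have hval : ∀ j : ZMod (X.len c), G (j + 1 - i).val = G ((j - i).val + 1) := by
    intro j
    have e : j + 1 - i = (((j - i).val + 1 : ℕ) : ZMod (X.len c)) := by
      rw [Nat.cast_add, ZMod.natCast_zmod_val, Nat.cast_one]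
      ring
    rw [e, ZMod.val_natCast]
    have hlt := ZMod.val_lt (j - i)
    rcases Nat.lt_or_eq_of_le (Nat.succ_le_of_lt hlt) with hl | hl
    · rw [Nat.mod_eq_of_lt hl]
    · rw [show (j - i).val + 1 = X.len c from hl, Nat.mod_self, hGl]
      rfl
  let q : A.TotalCell := ⟨⟨c, fun j => G (j - i).val⟩, fun j => by
    have h₁ := hGp (j - i).val
    have h₂ := hG (j - i).val
    rw [hcast] at h₁ h₂
    exact ⟨h₁, by rw [← h₂, ← hval]⟩⟩
  refine ⟨⟨q, i, true⟩, A.totalEdge_ext ?_ ?_, rfl⟩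
  · refine (A.totalOrg_liftDart (q.2 i).1).trans ?_
    simp only [q, sub_self, ZMod.val_zero]
    rfl
  · exact (A.projDart_liftDart (q.2 i).1).trans h

/-- A lifted polygon is determined by one corner, because each corner is the action of the preceding
side on the preceding corner. -/
theorem cell_ext {q q' : A.TotalCell} {i : ZMod (X.len q.1.1)} {i' : ZMod (X.len q'.1.1)}
    {b b' : Bool} (h : (⟨q.1.1, i, b⟩ : X.Flag) = ⟨q'.1.1, i', b'⟩)
    (hd : A.liftDart (q.2 i).1 = A.liftDart (q'.2 i').1) :
    (⟨q, i, b⟩ : A.total.Flag) = ⟨q', i', b'⟩ := by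
  obtain ⟨⟨c, g⟩, hg⟩ := q
  obtain ⟨⟨c', g'⟩, hg'⟩ := q'
  obtain ⟨rfl, h⟩ := Sigma.mk.inj h
  obtain ⟨rfl, rfl⟩ := Prod.mk.inj (eq_of_heq h)
  have : NeZero (X.len c) := ⟨(X.len_pos c).ne'⟩
  have h₀ : g i = g' i := by
    have := congrArg A.totalOrg hd
    rwa [totalOrg_liftDart, totalOrg_liftDart] at this
  have hk : ∀ k : ℕ, g (i + k) = g' (i + k) := by
    intro k
    induction k with
    | zero => simpa using h₀
    | succ k ih =>
      rw [Nat.cast_succ, ← add_assoc]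
      exact ((hg _).2.symm.trans (congrArg (fun P => A.act P (X.bd c (i + k))) ih)).trans (hg' _).2
  obtain rfl : g = g' := by
    funext j
    have := hk (j - i).val
    rwa [ZMod.natCast_zmod_val, add_sub_cancel] at this
  rfl

theorem isCovering_projHom : A.projHom.IsCovering where
  bijOn_darts v := by
    refine ⟨fun d hd => ?_, fun d hd d' hd' h => ?_, fun d hd => ?_⟩
    · exact (A.projHom.map_org d).trans (congrArg _ hd)
    · exact A.totalEdge_ext (Eq.trans hd (Eq.symm hd')) h
    · exact A.exists_totalEdge hd
  bijOn_flags d := by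
    refine ⟨fun f hf => ?_, fun f hf f' hf' h => ?_, fun f hf => ?_⟩
    · exact (A.projHom.map_dart f).trans (congrArg _ hf)
    · have hd : f.dart = f'.dart := Eq.trans hf (Eq.symm hf')
      have hb : f.2.2 = f'.2.2 := congrArg (fun f : X.Flag => f.2.2) h
      obtain ⟨q, i, b⟩ := f
      obtain ⟨q', i', b'⟩ := f'
      obtain rfl : b = b' := hb
      refine A.cell_ext h ?_
      cases b
      · exact rev_inj.1 hd
      · exact hd
    · obtain ⟨c, i, _ | _⟩ := f
      -- A negatively directed side is obtained by flipping the positive one above the reversed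
      -- oriented edge.
      · have h : X.bd c i = A.projDart (rev d) := by
          rw [← rev_rev (X.bd c i)]
          exact congrArg rev hf
        obtain ⟨f, h₁, h₂⟩ := A.exists_flag_of_positive h
        refine ⟨f.flip, ?_, ?_⟩
        · change f.flip.dart = d
          rw [Flag.dart_flip, h₁, rev_rev]
        · rw [A.projHom.map_flip, h₂]
          rfl
      · exact A.exists_flag_of_positive hf

theorem target_eq_foldl {P Q : A.total.Vert} {l : List A.total.Dart} (h : IsPath P l Q) :
    Q = (l.map A.projHom.onDart).foldl A.act P := by
  induction l generalizing P with
  | nil => exact Eq.symm h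
  | cons d l ih =>
    have hd : dst d = A.act P (A.projDart d) := by
      rw [← h.1]
      exact (A.act_projDart d).symm
    exact (ih h.2).trans (congrArg (fun P => (l.map A.projHom.onDart).foldl A.act P) hd)

end PathAction

/-! ### The covering associated to a subgroup of the fundamental group -/

/-- The final vertex of an edge path starting at `x`. -/
def pathEnd (x : X.Vert) (l : List X.Dart) : X.Vert := l.foldl (fun _ d => dst d) x

theorem IsPath.pathEnd_eq {l : List X.Dart} {x v : X.Vert} (h : IsPath x l v) :
    pathEnd x l = v := by
  induction l generalizing x with
  | nil => exact h
  | cons d l ih => exact ih h.2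

section subgroupCover

variable {x : X.Vert} (H : Subgroup (X.FundGroup x))

theorem mk_append_reverse_eq_one {v : X.Vert} {l : List X.Dart} (h : IsPath x l v) :
    FundGroup.mk (l ++ (l.map rev).reverse) (h.append h.reverse) = 1 :=
  FundGroup.mk_eq_mk.2 (Homotopic.append_reverse (⟨l, h⟩ : X.EdgePath x v))

/-- The middle segment $m^{-1}m$ cancels. This gives symmetry and transitivity of the coset
relation. -/
theorem mk_append_reverse_mul {v : X.Vert} {l m n : List X.Dart} (hl : IsPath x l v)
    (hm : IsPath x m v) (hn : IsPath x n v) :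
    FundGroup.mk (l ++ (m.map rev).reverse) (hl.append hm.reverse) *
      FundGroup.mk (m ++ (n.map rev).reverse) (hm.append hn.reverse) =
      FundGroup.mk (l ++ (n.map rev).reverse) (hl.append hn.reverse) := by
  rw [FundGroup.mk_mul_mk, FundGroup.mk_eq_mk]
  let a : X.EdgePath x v := ⟨l, hl⟩
  let b : X.EdgePath x v := ⟨m, hm⟩
  let c : X.EdgePath x v := ⟨n, hn⟩
  have h := ((Homotopic.reverse_append b).append_left a).append_right c.reverse
  simpa [EdgePath.append, EdgePath.reverse, EdgePath.nil, a, b, c] using h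

/-- Edge paths starting at `x`, with the relation of differing by an element of `H`. -/
def cosetSetoid : Setoid {l : List X.Dart // ∃ v, IsPath x l v} where
  r a b := ∃ (v : X.Vert) (ha : IsPath x a.1 v) (hb : IsPath x b.1 v),
    FundGroup.mk (a.1 ++ (b.1.map rev).reverse) (ha.append hb.reverse) ∈ H
  iseqv := by
    refine ⟨?_, ?_, ?_⟩
    · rintro ⟨l, v, h⟩
      refine ⟨v, h, h, ?_⟩
      rw [mk_append_reverse_eq_one h]
      exact H.one_mem
    · rintro a b ⟨v, ha, hb, h⟩
      refine ⟨v, hb, ha, ?_⟩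
      have e := mk_append_reverse_mul ha hb ha
      rw [mk_append_reverse_eq_one ha] at e
      rw [eq_inv_of_mul_eq_one_right e]
      exact H.inv_mem h
    · rintro a b c ⟨v, ha, hb, h⟩ ⟨v', hb', hc, h'⟩
      obtain rfl := hb.target_unique hb'
      refine ⟨v, ha, hc, ?_⟩
      rw [← mk_append_reverse_mul ha hb hc]
      exact H.mul_mem h h'

/-- The vertices of the covering associated to `H`. -/
def CosetVert : Type u := Quotient (cosetSetoid H)

/-- The vertex of the covering associated to an edge path. -/
def cosetMk {v : X.Vert} (l : List X.Dart) (h : IsPath x l v) : CosetVert H :=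
  Quotient.mk (cosetSetoid H) ⟨l, v, h⟩

variable {H}

theorem exists_cosetMk (P : CosetVert H) : ∃ (v : X.Vert) (l : List X.Dart) (h : IsPath x l v),
    P = cosetMk H l h := by
  obtain ⟨l, v, h⟩ := P
  exact ⟨v, l, h, rfl⟩

theorem cosetMk_eq {v : X.Vert} {l m : List X.Dart} {hl : IsPath x l v} {hm : IsPath x m v} :
    cosetMk H l hl = cosetMk H m hm ↔
      FundGroup.mk (l ++ (m.map rev).reverse) (hl.append hm.reverse) ∈ H := by
  refine (Quotient.eq (r := cosetSetoid H)).trans ⟨?_, fun h => ⟨v, hl, hm, h⟩⟩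
  rintro ⟨w, hl', _, h⟩
  obtain rfl := hl'.target_unique hl
  exact h

theorem cosetMk_eq_of_homotopic {v : X.Vert} {l m : List X.Dart} {hl : IsPath x l v}
    {hm : IsPath x m v} (h : Homotopic (⟨l, hl⟩ : X.EdgePath x v) ⟨m, hm⟩) :
    cosetMk H l hl = cosetMk H m hm := by
  rw [cosetMk_eq]
  have e : FundGroup.mk (l ++ (m.map rev).reverse) (hl.append hm.reverse) =
      FundGroup.mk (m ++ (m.map rev).reverse) (hm.append hm.reverse) :=
    FundGroup.mk_eq_mk.2 (h.append_right (EdgePath.reverse ⟨m, hm⟩))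
  rw [e, mk_append_reverse_eq_one hm]
  exact H.one_mem

/-- The vertex of `X` below a vertex of the covering. -/
def cosetProj : CosetVert H → X.Vert :=
  Quotient.lift (fun l => pathEnd x l.1) fun _ _ ⟨_, ha, hb, _⟩ =>
    ha.pathEnd_eq.trans hb.pathEnd_eq.symm

theorem cosetProj_mk {v : X.Vert} {l : List X.Dart} (h : IsPath x l v) :
    cosetProj (cosetMk H l h) = v := h.pathEnd_eq

open Classical in
/-- The action of an oriented edge on the vertices of the covering. -/
noncomputable def cosetAct (P : CosetVert H) (d : X.Dart) : CosetVert H :=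
  if h : ∃ l : List X.Dart, ∃ hl : IsPath x l (org d), P = cosetMk H l hl then
    cosetMk H (h.choose ++ [d]) (h.choose_spec.choose.append (isPath_singleton d))
  -- Default value when `d` does not start at the projection of `P`; the axioms of a path action
  -- never evaluate it.
  else P

/-- Independence of the representative for the action: $l n n^{-1} m^{-1}$ is homotopic to $l
m^{-1}$. -/
theorem cosetMk_append {v w : X.Vert} {l m n : List X.Dart} {hl : IsPath x l v}
    {hm : IsPath x m v} (h : cosetMk H l hl = cosetMk H m hm) (hn : IsPath v n w) :
    cosetMk H (l ++ n) (hl.append hn) = cosetMk H (m ++ n) (hm.append hn) := by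
  rw [cosetMk_eq] at h ⊢
  convert h using 1
  rw [FundGroup.mk_eq_mk]
  let a : X.EdgePath x v := ⟨l, hl⟩
  let b : X.EdgePath x v := ⟨m, hm⟩
  let c : X.EdgePath v w := ⟨n, hn⟩
  have h := ((Homotopic.append_reverse c).append_left a).append_right b.reverse
  simpa [EdgePath.append, EdgePath.reverse, EdgePath.nil, a, b, c] using h

theorem cosetAct_mk {d : X.Dart} {l : List X.Dart} (hl : IsPath x l (org d)) :
    cosetAct (cosetMk H l hl) d = cosetMk H (l ++ [d]) (hl.append (isPath_singleton d)) := by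
  have h : ∃ m : List X.Dart, ∃ hm : IsPath x m (org d), cosetMk H l hl = cosetMk H m hm :=
    ⟨l, hl, rfl⟩
  rw [cosetAct, dif_pos h]
  exact (cosetMk_append h.choose_spec.choose_spec (isPath_singleton d)).symm

theorem foldl_cosetAct {v w : X.Vert} {l m : List X.Dart} (hl : IsPath x l v)
    (hm : IsPath v m w) :
    m.foldl cosetAct (cosetMk H l hl) = cosetMk H (l ++ m) (hl.append hm) := by
  induction m generalizing v l with
  | nil => cases hm; simp
  | cons d m ih =>
    obtain ⟨rfl, hm⟩ := hm
    rw [List.foldl_cons, cosetAct_mk, ih _ hm]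
    simp

variable (H)

/-- The action of edge paths on the cosets of `H`. -/
noncomputable def cosetAction : PathAction X where
  Pt := CosetVert H
  proj := cosetProj
  act := cosetAct
  proj_act P d h := by
    obtain ⟨v, l, hl, rfl⟩ := exists_cosetMk P
    rw [cosetProj_mk] at h
    subst h
    rw [cosetAct_mk, cosetProj_mk]
  act_rev P d h := by
    obtain ⟨v, l, hl, rfl⟩ := exists_cosetMk P
    rw [cosetProj_mk] at h
    subst h
    have hd : IsPath (org d) [d, rev d] (org d) := ⟨rfl, org_rev d, dst_rev d⟩
    refine (foldl_cosetAct hl hd).trans (cosetMk_eq_of_homotopic (.symm _ _ (.rel _ _ ?_)))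
    simpa using Step.backtrack l [] d
  act_boundary P f h := by
    obtain ⟨v, l, hl, rfl⟩ := exists_cosetMk P
    rw [cosetProj_mk] at h
    subst h
    refine (foldl_cosetAct hl (isPath_boundary f)).trans
      (cosetMk_eq_of_homotopic (.symm _ _ (.rel _ _ ?_)))
    simpa using Step.cell l [] f

/-- For every subgroup `H` of the fundamental group there is a connected covering whose fundamental
group has image `H`. -/
theorem exists_covering_of_subgroup : ∃ (Y : TwoComplex.{u}) (p : Hom Y X) (y : Y.Vert)
    (hy : p.onVert y = x), p.IsCovering ∧ Y.IsConnected ∧ (p.mapFundGroup hy).range = H := by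
  let A := cosetAction H
  have hp := A.isCovering_projHom
  let y : A.total.Vert := cosetMk H [] (rfl : x = x)
  have hy : A.projHom.onVert y = x := cosetProj_mk (H := H) (l := []) rfl
  -- A path from the base vertex ends at the coset of its own projection. Hence the lift of a loop
  -- is closed exactly when its class lies in `H`.
  have key : ∀ {l : List A.total.Dart} {Q : A.total.Vert} {v : X.Vert}, IsPath y l Q →
      ∀ hl : IsPath x (l.map A.projHom.onDart) v,
      Q = cosetMk H (l.map A.projHom.onDart) hl := fun {l Q v} h hl =>
    (A.target_eq_foldl h).trans (foldl_cosetAct (H := H) (l := []) rfl hl)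
  have hreach : ∀ Q : A.total.Vert, Nonempty (A.total.EdgePath y Q) := by
    intro Q
    obtain ⟨v, l, hl, rfl⟩ := exists_cosetMk Q
    obtain ⟨m, Q', hm, rfl, -⟩ := hp.exists_lift (v := y) (hy.symm ▸ hl)
    rw [← key hm hl]
    exact ⟨⟨m, hm⟩⟩
  refine ⟨A.total, A.projHom, y, hy, hp, ⟨⟨y⟩, fun Q Q' => ?_⟩, le_antisymm ?_ ?_⟩
  · obtain ⟨a⟩ := hreach Q
    obtain ⟨b⟩ := hreach Q'
    exact ⟨a.reverse.append b⟩
  · rintro _ ⟨a, rfl⟩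
    obtain ⟨l, hl, rfl⟩ := FundGroup.mk_surjective a
    rw [Hom.mapFundGroup_mk]
    have h := key hl (hy ▸ A.projHom.isPath_map hl)
    simpa using cosetMk_eq.1 h.symm
  · intro a ha
    obtain ⟨l, hl, rfl⟩ := FundGroup.mk_surjective a
    obtain ⟨m, Q, hm, rfl, -⟩ := hp.exists_lift (v := y) (hy.symm ▸ hl)
    obtain rfl : Q = y := by
      rw [key hm hl]
      exact cosetMk_eq.2 (by simpa using ha)
    exact ⟨FundGroup.mk m hm, rfl⟩

end subgroupCover


/-! ### Finite presentation -/

/-- The element of the free group on the edges defined by an oriented edge. -/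
def dartWord (d : X.Dart) : FreeGroup X.Edge :=
  bif d.2 then FreeGroup.of d.1 else (FreeGroup.of d.1)⁻¹

theorem dartWord_rev (d : X.Dart) : dartWord (rev d) = (dartWord d)⁻¹ := by
  rcases d with ⟨e, _ | _⟩ <;> simp [dartWord, rev]

/-- The word in the edges of `X` read along a list of oriented edges. -/
def pathWord (l : List X.Dart) : FreeGroup X.Edge := (l.map dartWord).prod

theorem pathWord_append (l m : List X.Dart) : pathWord (l ++ m) = pathWord l * pathWord m := by
  simp [pathWord]

theorem pathWord_reverse (l : List X.Dart) : pathWord (l.map rev).reverse = (pathWord l)⁻¹ := by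
  induction l with
  | nil => simp [pathWord]
  | cons d l ih =>
    rw [List.map_cons, List.reverse_cons, pathWord_append, ih]
    simp [pathWord, dartWord_rev]

theorem IsCompact.finite_flag (h : X.IsCompact) : Finite X.Flag := by
  have := h.2.2
  have : ∀ c : X.Cell, NeZero (X.len c) := fun c => ⟨(X.len_pos c).ne'⟩
  infer_instance

section presentation

variable {x : X.Vert} (t : ∀ v : X.Vert, X.EdgePath x v)

/-- The relators of the presentation of the fundamental group determined by a choice `t` of
edge paths from the base vertex. -/
def relators : Set (FreeGroup X.Edge) :=
  Set.range (fun f : X.Flag => pathWord f.boundary) ∪ Set.range fun v => pathWord (t v).1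

/-- The closed path that runs along `d`, and is connected to the base vertex by the paths `t`. -/
def dartLoop (d : X.Dart) : X.EdgePath x x :=
  ((t (org d)).append ⟨[d], isPath_singleton d⟩).append (t (dst d)).reverse

/-- The homomorphism from the free group on the edges to the fundamental group. -/
def ofWord : FreeGroup X.Edge →* X.FundGroup x :=
  FreeGroup.lift fun e => FundGroup.mk _ (dartLoop t (e, true)).2

theorem mk_congr {l m : List X.Dart} (h : l = m) (hl : IsPath x l x) :
    FundGroup.mk l hl = FundGroup.mk m (h ▸ hl) := by
  subst h
  rfl

theorem ofWord_dartWord (d : X.Dart) :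
    ofWord t (dartWord d) = FundGroup.mk _ (dartLoop t d).2 := by
  rcases d with ⟨e, _ | _⟩
  · rw [dartWord, cond_false, map_inv, ofWord, FreeGroup.lift_apply_of, FundGroup.mk_inv]
    refine mk_congr ?_ _
    simp [dartLoop, EdgePath.append, EdgePath.reverse, List.map_reverse, Function.comp_def]
    rfl
  · rw [dartWord, cond_true, ofWord, FreeGroup.lift_apply_of]

/-- The connecting paths between consecutive edges cancel, leaving only those at the two ends. -/
theorem ofWord_pathWord {l : List X.Dart} {v w : X.Vert} (h : IsPath v l w) :
    ofWord t (pathWord l) = FundGroup.mk _ (((t v).append ⟨l, h⟩).append (t w).reverse).2 := by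
  induction l generalizing v with
  | nil =>
    cases h
    refine Eq.symm (FundGroup.mk_eq_mk.2 ?_)
    simpa [EdgePath.append, EdgePath.nil] using Homotopic.append_reverse (t _)
  | cons d l ih =>
    obtain ⟨rfl, h⟩ := h
    rw [pathWord, List.map_cons, List.prod_cons, map_mul, ofWord_dartWord, ← pathWord, ih h,
      FundGroup.mk_mul_mk, FundGroup.mk_eq_mk]
    have := ((Homotopic.reverse_append (t (dst d))).append_left
      ((t (org d)).append ⟨[d], isPath_singleton d⟩)).append_right
      (EdgePath.append (⟨l, h⟩ : X.EdgePath (dst d) w) (t w).reverse)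
    simpa [EdgePath.append, EdgePath.reverse, EdgePath.nil, dartLoop] using this

theorem ofWord_pathWord_loop (ht : t x = EdgePath.nil x) {l : List X.Dart} (h : IsPath x l x) :
    ofWord t (pathWord l) = FundGroup.mk l h := by
  rw [ofWord_pathWord t h]
  refine mk_congr ?_ _
  rw [ht]
  simp [EdgePath.append, EdgePath.reverse, EdgePath.nil]

/-- The word read along a closed path, in the group presented by the relators. -/
def wordOfLoop : X.FundGroup x →* FreeGroup X.Edge ⧸ Subgroup.normalClosure (relators t) where
  toFun := Quotient.lift (fun a => QuotientGroup.mk' _ (pathWord a.1)) fun a b hab => by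
    change Homotopic a b at hab
    induction hab with
    | rel a b h =>
      obtain ⟨a, ha⟩ := a
      obtain ⟨b, hb⟩ := b
      cases (h : Step a b) with
      | backtrack l₁ l₂ d => simp [pathWord, dartWord_rev]
      | cell l₁ l₂ f =>
        have : QuotientGroup.mk' (Subgroup.normalClosure (relators t)) (pathWord f.boundary) = 1 :=
          (QuotientGroup.eq_one_iff _).2 (Subgroup.subset_normalClosure (Or.inl ⟨f, rfl⟩))
        change QuotientGroup.mk' _ (pathWord (l₁ ++ l₂)) =
          QuotientGroup.mk' _ (pathWord (l₁ ++ f.boundary ++ l₂))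
        simp only [pathWord_append, map_mul, this, mul_one]
    | refl _ => rfl
    | symm _ _ _ ih => exact ih.symm
    | trans _ _ _ _ _ ih₁ ih₂ => exact ih₁.trans ih₂
  map_one' := by
    change QuotientGroup.mk' _ (pathWord []) = 1
    simp [pathWord]
  map_mul' := by
    rintro ⟨a⟩ ⟨b⟩
    exact (congrArg (QuotientGroup.mk' _) (pathWord_append a.1 b.1)).trans
      (map_mul (QuotientGroup.mk' _) _ _)

theorem wordOfLoop_mk {l : List X.Dart} (h : IsPath x l x) :
    wordOfLoop t (FundGroup.mk l h) = QuotientGroup.mk' _ (pathWord l) := rfl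

/-- The loop of an edge reads as that edge multiplied by words of connecting paths, which are
relators. This bounds the kernel of `ofWord` from above. -/
theorem wordOfLoop_comp_ofWord : (wordOfLoop t).comp (ofWord t) = QuotientGroup.mk' _ := by
  have ht : ∀ v, QuotientGroup.mk' (Subgroup.normalClosure (relators t)) (pathWord (t v).1) = 1 :=
    fun v => (QuotientGroup.eq_one_iff _).2 (Subgroup.subset_normalClosure (Or.inr ⟨v, rfl⟩))
  ext e
  rw [MonoidHom.comp_apply, ofWord, FreeGroup.lift_apply_of, wordOfLoop_mk]
  change QuotientGroup.mk' _ (pathWord ((t (X.src e)).1 ++ [(e, true)] ++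
    ((t (X.tgt e)).1.map rev).reverse)) = _
  rw [pathWord_append, pathWord_append, pathWord_reverse, map_mul, map_mul, map_inv, ht, ht]
  simp [pathWord, dartWord]

theorem ker_ofWord (ht : t x = EdgePath.nil x) :
    (ofWord t).ker = Subgroup.normalClosure (relators t) := by
  refine le_antisymm (fun g hg => ?_) (Subgroup.normalClosure_le_normal ?_)
  · have h := DFunLike.congr_fun (wordOfLoop_comp_ofWord t) g
    rw [MonoidHom.comp_apply, MonoidHom.mem_ker.1 hg, map_one] at h
    exact (QuotientGroup.eq_one_iff g).1 h.symm
  -- Conversely each relator maps to a null-homotopic loop: a conjugated 2-cell boundary, or `t v`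
  -- followed by its reverse, the initial connecting path being trivial by `ht`.
  · rintro _ (⟨f, rfl⟩ | ⟨v, rfl⟩)
    · refine (ofWord_pathWord t (isPath_boundary f)).trans (FundGroup.mk_eq_mk.2 ?_)
      refine Relation.EqvGen.trans _ ((t (org f.dart)).append (t (org f.dart)).reverse) _
        (.symm _ _ (.rel _ _ ?_)) (Homotopic.append_reverse _)
      exact Step.cell _ _ f
    · refine (ofWord_pathWord t (t v).2).trans (FundGroup.mk_eq_mk.2 ?_)
      have := Homotopic.append_reverse (t v)
      rw [ht]
      exact this

end presentation

/-- The fundamental group of a compact connected complex is finitely presented. -/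
theorem isFinitelyPresented_fundGroup (hc : X.IsCompact) (hX : X.IsConnected) (x : X.Vert) :
    Group.IsFinitelyPresented (X.FundGroup x) := by
  classical
  have := hc.1
  have := hc.2.1
  have := hc.finite_flag
  obtain ⟨t, ht⟩ : ∃ t : ∀ v : X.Vert, X.EdgePath x v, t x = EdgePath.nil x :=
    ⟨Function.update (fun v => (hX.2 x v).some) x (EdgePath.nil x), Function.update_self ..⟩
  refine Group.IsFinitelyPresented.of_surjective (ofWord t) (fun a => ?_)
    ⟨relators t, (Set.finite_range _).union (Set.finite_range _), (ker_ofWord t ht).symm⟩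
  obtain ⟨l, hl, rfl⟩ := FundGroup.mk_surjective a
  exact ⟨_, ofWord_pathWord_loop t ht hl⟩


/-! ### Subcomplexes -/

namespace Subcomplex

variable {A : Subcomplex X}

theorem org_mem {d : X.Dart} (h : d.1 ∈ A.edges) : org d ∈ A.verts := by
  obtain ⟨e, _ | _⟩ := d
  · exact A.tgt_mem e h
  · exact A.src_mem e h

theorem dst_mem {d : X.Dart} (h : d.1 ∈ A.edges) : dst d ∈ A.verts := by
  rw [← org_rev]
  exact org_mem (d := rev d) h

/-- An edge path that runs in a subcomplex. -/
theorem exists_path {l : List X.Dart} {v w : X.Vert} (h : IsPath v l w) (hv : v ∈ A.verts)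
    (hw : w ∈ A.verts) (hl : ∀ d ∈ l, d.1 ∈ A.edges) :
    ∃ m, IsPath (X := A.toComplex) ⟨v, hv⟩ m ⟨w, hw⟩ ∧ m.map A.incl.onDart = l := by
  induction l generalizing v with
  | nil => exact ⟨[], Subtype.ext h, rfl⟩
  | cons d l ih =>
    have hd := hl d List.mem_cons_self
    obtain ⟨m, hm, hml⟩ := ih h.2 (dst_mem hd) fun e he => hl e (List.mem_cons_of_mem _ he)
    let d' : A.toComplex.Dart := (⟨d.1, hd⟩, d.2)
    have ho : org d' = ⟨v, hv⟩ := Subtype.ext ((A.incl.map_org d').symm.trans h.1)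
    have ht : dst d' = ⟨dst d, dst_mem hd⟩ := Subtype.ext (A.incl.map_dst d').symm
    exact ⟨d' :: m, ⟨ho, by rw [ht]; exact hm⟩, by rw [List.map_cons, hml]; rfl⟩

theorem isConnected_toComplex {x : X.Vert} (hx : x ∈ A.verts)
    (h : ∀ w ∈ A.verts, ∃ l, IsPath x l w ∧ ∀ d ∈ l, d.1 ∈ A.edges) :
    A.toComplex.IsConnected := by
  have h' : ∀ w : A.toComplex.Vert, Nonempty (A.toComplex.EdgePath ⟨x, hx⟩ w) := by
    intro w
    obtain ⟨l, hl, hlA⟩ := h w.1 w.2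
    obtain ⟨m, hm, -⟩ := exists_path hl hx w.2 hlA
    exact ⟨⟨m, hm⟩⟩
  refine ⟨⟨⟨x, hx⟩⟩, fun v w => ?_⟩
  obtain ⟨a⟩ := h' v
  obtain ⟨b⟩ := h' w
  exact ⟨a.reverse.append b⟩

theorem incl_onDart_injective (A : Subcomplex X) : Function.Injective A.incl.onDart := by
  rintro ⟨⟨e, he⟩, b⟩ ⟨⟨e', he'⟩, b'⟩ h
  obtain ⟨rfl, rfl⟩ := Prod.mk.inj h
  rfl

theorem isCompact_toComplex (hv : A.verts.Finite) (he : A.edges.Finite) (hc : A.cells.Finite) :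
    A.toComplex.IsCompact := ⟨hv, he, hc⟩

/-- The subcomplex of vertices and edges traversed by a set of oriented edges. -/
def ofDarts (D : Set X.Dart) : Subcomplex X where
  verts := org '' D ∪ dst '' D
  edges := Prod.fst '' D
  cells := ∅
  src_mem := by
    rintro _ ⟨⟨e, _ | _⟩, h, rfl⟩
    · exact Or.inr ⟨_, h, rfl⟩
    · exact Or.inl ⟨_, h, rfl⟩
  tgt_mem := by
    rintro _ ⟨⟨e, _ | _⟩, h, rfl⟩
    · exact Or.inl ⟨_, h, rfl⟩
    · exact Or.inr ⟨_, h, rfl⟩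
  bd_mem _ h := h.elim

/-- The union of two subcomplexes. -/
def union (A B : Subcomplex X) : Subcomplex X where
  verts := A.verts ∪ B.verts
  edges := A.edges ∪ B.edges
  cells := A.cells ∪ B.cells
  src_mem _ h := h.imp (A.src_mem _) (B.src_mem _)
  tgt_mem _ h := h.imp (A.tgt_mem _) (B.tgt_mem _)
  bd_mem c h i := h.imp (fun h => A.bd_mem c h i) fun h => B.bd_mem c h i

/-- A single vertex. -/
def point (x : X.Vert) : Subcomplex X where
  verts := {x}
  edges := ∅
  cells := ∅
  src_mem _ h := h.elim
  tgt_mem _ h := h.elim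
  bd_mem _ h := h.elim

/-- In a connected complex every compact subcomplex is contained in a compact connected one. -/
theorem exists_connected_le (hX : X.IsConnected) (C : Subcomplex X) (hC : C.toComplex.IsCompact) :
    ∃ B : Subcomplex X, C ≤ B ∧ B.toComplex.IsCompact ∧ B.toComplex.IsConnected := by
  obtain ⟨x⟩ := hX.1
  let t : ∀ v, X.EdgePath x v := fun v => (hX.2 x v).some
  let D : Set X.Dart := ⋃ v ∈ C.verts, {d | d ∈ (t v).1}
  have hCv : C.verts.Finite := hC.1
  have hCe : C.edges.Finite := hC.2.1
  have hCc : C.cells.Finite := hC.2.2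
  have hD : D.Finite := hCv.biUnion fun v _ => List.finite_toSet _
  -- The base point is added because `C` may be empty, while a connected complex is not.
  let B : Subcomplex X := (C.union (ofDarts D)).union (point x)
  have hB : ∀ d ∈ D, d.1 ∈ B.edges := fun d hd => Or.inl (Or.inr ⟨d, hd, rfl⟩)
  have ht : ∀ v ∈ C.verts, ∀ d ∈ (t v).1, d ∈ D := fun v hv d hd => Set.mem_biUnion hv hd
  have horg : ∀ d ∈ D, ∃ l, IsPath x l (org d) ∧ ∀ e ∈ l, e.1 ∈ B.edges := by
    intro d hd
    obtain ⟨v, hv, hdv⟩ := Set.mem_iUnion₂.1 hd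
    -- The part of `t v` before `d` joins the base point to the origin of `d` inside `B`.
    obtain ⟨l₁, l₂, hl⟩ := List.append_of_mem hdv
    have hp := (t v).2
    rw [hl] at hp
    obtain ⟨u, hu, hu'⟩ := isPath_append.1 hp
    rw [hu'.1]
    refine ⟨l₁, hu, fun e he => hB _ (ht v hv e ?_)⟩
    rw [hl]
    exact List.mem_append_left _ he
  refine ⟨B, ⟨fun v h => Or.inl (Or.inl h), fun v h => Or.inl (Or.inl h),
    fun v h => Or.inl (Or.inl h)⟩, isCompact_toComplex ?_ ?_ ?_,
    isConnected_toComplex (x := x) (Or.inr rfl) ?_⟩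
  · exact (hCv.union ((hD.image _).union (hD.image _))).union (Set.finite_singleton x)
  · exact (hCe.union (hD.image _)).union Set.finite_empty
  · exact (hCc.union Set.finite_empty).union Set.finite_empty
  · rintro w ((hw | ⟨d, hd, rfl⟩ | ⟨d, hd, rfl⟩) | rfl)
    · exact ⟨(t w).1, (t w).2, fun d hd => hB _ (ht w hw d hd)⟩
    · exact horg d hd
    · obtain ⟨l, hl, hlB⟩ := horg d hd
      refine ⟨l ++ [d], hl.append (isPath_singleton d), fun e he => ?_⟩
      rcases List.mem_append.1 he with he | he
      · exact hlB e he
      · rw [List.mem_singleton.1 he]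
        exact hB d hd
    · exact ⟨[], rfl, fun d hd => by simp at hd⟩

end Subcomplex

/-! ### Images of combinatorial maps -/

theorem Hom.fst_onDart (f : Hom Y X) (d : Y.Dart) : (f.onDart d).1 = f.onEdge d.1 := by
  obtain ⟨e, _ | _⟩ := d
  · exact (congrArg Prod.fst (f.map_rev (e, true)) :)
  · rfl

theorem Hom.side_onFlag (f : Hom Y X) (t : Y.Flag) : (f.onFlag t).side = f.onSide t.side := by
  obtain ⟨c, i, _ | _⟩ := t
  · exact (congrArg Flag.side (f.map_flip ⟨c, i, true⟩) :)
  · rfl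

theorem Flag.dart_fst (t : X.Flag) : t.dart.1 = t.side.edge := by
  obtain ⟨c, i, _ | _⟩ := t <;> rfl

/-- Walking around the polygon reaches every side. Thus all sides of an image cell are images of
sides, and the image of a map is a subcomplex. -/
theorem Flag.exists_iterate_side (s : X.Flag) (i : ZMod (X.len s.1)) :
    ∃ k : ℕ, (Flag.next^[k] s).side = ⟨s.1, i⟩ := by
  obtain ⟨c, j, b⟩ := s
  have : NeZero (X.len c) := ⟨(X.len_pos c).ne'⟩
  change ZMod (X.len c) at i
  cases b
  · refine ⟨(j - i).val, ?_⟩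
    rw [Flag.next_iterate]
    simp [Flag.side]
  · refine ⟨(i - j).val, ?_⟩
    rw [Flag.next_iterate]
    simp [Flag.side]

/-- The image of a combinatorial map. -/
def Hom.image (f : Hom Y X) : Subcomplex X where
  verts := Set.range f.onVert
  edges := Set.range f.onEdge
  cells := Set.range fun t : Y.Flag => (f.onFlag t).1
  src_mem := by
    rintro _ ⟨e, rfl⟩
    rcases h : f.onDart (e, true) with ⟨e', _ | _⟩
    · refine ⟨Y.tgt e, ?_⟩
      rw [Hom.onEdge, h]
      exact (f.map_dst (e, true)).symm.trans (by rw [h]; rfl)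
    · refine ⟨Y.src e, ?_⟩
      rw [Hom.onEdge, h]
      exact (f.map_org (e, true)).symm.trans (by rw [h]; rfl)
  tgt_mem := by
    rintro _ ⟨e, rfl⟩
    rcases h : f.onDart (e, true) with ⟨e', _ | _⟩
    · refine ⟨Y.src e, ?_⟩
      rw [Hom.onEdge, h]
      exact (f.map_org (e, true)).symm.trans (by rw [h]; rfl)
    · refine ⟨Y.tgt e, ?_⟩
      rw [Hom.onEdge, h]
      exact (f.map_dst (e, true)).symm.trans (by rw [h]; rfl)
  bd_mem := by
    rintro _ ⟨t, rfl⟩ i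
    obtain ⟨k, hk⟩ := Flag.exists_iterate_side (f.onFlag t) i
    refine ⟨(Flag.next^[k] t).dart.1, ?_⟩
    rw [← f.fst_onDart, ← f.map_dart, f.map_next_iterate, Flag.dart_fst, hk]
    rfl

theorem Hom.isCompact_image (f : Hom Y X) (h : Y.IsCompact) : f.image.toComplex.IsCompact := by
  have := h.1
  have := h.2.1
  have := h.finite_flag
  exact ⟨(Set.finite_range _ : (Set.range f.onVert).Finite),
    (Set.finite_range _ : (Set.range f.onEdge).Finite),
    (Set.finite_range _ : (Set.range fun t : Y.Flag => (f.onFlag t).1).Finite)⟩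

theorem Hom.isConnected_image (f : Hom Y X) (h : Y.IsConnected) :
    f.image.toComplex.IsConnected := by
  obtain ⟨y⟩ := h.1
  refine Subcomplex.isConnected_toComplex (x := f.onVert y) ⟨y, rfl⟩ ?_
  rintro _ ⟨w, rfl⟩
  obtain ⟨a⟩ := h.2 y w
  refine ⟨_, f.isPath_map a.2, fun d hd => ?_⟩
  obtain ⟨e, -, rfl⟩ := List.mem_map.1 hd
  rw [f.fst_onDart]
  exact ⟨e.1, rfl⟩

/-! ### Perimeter of images -/

/-- All sides lie at a single edge, so `finite_at_edge` keeps the supports finite; a sum of infinite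
support would be zero by convention and break monotonicity. -/
theorem Weighting.sum_mono (W : X.Weighting) {e : X.Edge} {S T : Set X.Side}
    (hT : ∀ s ∈ T, s.edge = e) (h : S ⊆ T) : ∑ᶠ s ∈ S, W.wt s ≤ ∑ᶠ s ∈ T, W.wt s := by
  have hfin : ∀ U ⊆ T, (Function.support (U.indicator W.wt)).Finite := fun U hU =>
    (W.finite_at_edge e).subset fun s hs => by
      rw [Function.mem_support, Set.indicator_apply_ne_zero] at hs
      exact ⟨hT s (hU hs.1), hs.2⟩
  rw [finsum_mem_def, finsum_mem_def]
  exact finsum_le_finsum' (hfin S h) (hfin T subset_rfl) fun s =>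
    Set.indicator_le_indicator_of_subset h (fun _ => Nat.zero_le _) s

/-- Choose one edge of `Z` above each edge of the image. A side missing at the image edge is missing
at the chosen one, and the edges not chosen contribute nonnegative terms. -/
theorem Weighting.perimeter_image_le (W : X.Weighting) (p : Hom Y X) (ψ : Hom Z Y)
    (hZ : Z.IsCompact) :
    W.perimeter (p.comp ψ.image.incl) ≤ W.perimeter (p.comp ψ) := by
  have := hZ.2.1
  have := (ψ.isCompact_image hZ).2.1
  have := Fintype.ofFinite Z.Edge
  have := Fintype.ofFinite ψ.image.toComplex.Edge
  have hs : ∀ e : ψ.image.toComplex.Edge, ∃ z : Z.Edge, ψ.onEdge z = e.1 := fun e => e.2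
  choose s hs using hs
  have hinj : Function.Injective s := fun e e' h => Subtype.ext (by rw [← hs, ← hs, h])
  have hedge : ∀ e, (p.comp ψ.image.incl).onEdge e = (p.comp ψ).onEdge (s e) := by
    intro e
    change (p.onDart (e.1, true)).1 = (p.onDart (ψ.onDart (s e, true))).1
    rw [p.fst_onDart, p.fst_onDart, ψ.fst_onDart, hs]
  have hmiss : ∀ e, (p.comp ψ.image.incl).missing e ⊆ (p.comp ψ).missing (s e) := by
    rintro e σ ⟨h₁, h₂⟩
    refine ⟨h₁.trans (hedge e), fun ⟨t, ht, hσ⟩ => h₂ ?_⟩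
    -- A side of `Z` at `s e` that maps to `σ` would push forward to a side of the image at `e` that
    -- maps to `σ`.
    have hc : (ψ.onFlag ⟨t.1, t.2, true⟩).1 ∈ ψ.image.cells := ⟨_, rfl⟩
    refine ⟨⟨⟨_, hc⟩, (ψ.onFlag ⟨t.1, t.2, true⟩).2.1⟩, Subtype.ext ?_, ?_⟩
    · have h := Flag.dart_fst (ψ.onFlag ⟨t.1, t.2, true⟩)
      rw [ψ.map_dart, ψ.fst_onDart] at h
      refine Eq.trans h.symm ?_
      rw [← hs, ← ht]
      rfl
    · rw [← hσ]
      exact (p.side_onFlag (ψ.onFlag ⟨t.1, t.2, true⟩)).symm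
  unfold Weighting.perimeter
  rw [finsum_eq_sum_of_fintype, finsum_eq_sum_of_fintype]
  calc ∑ e, ∑ᶠ σ ∈ (p.comp ψ.image.incl).missing e, W.wt σ
      ≤ ∑ e, ∑ᶠ σ ∈ (p.comp ψ).missing (s e), W.wt σ :=
        Finset.sum_le_sum fun e _ => W.sum_mono (fun σ hσ => hσ.1) (hmiss e)
    _ = ∑ z ∈ Finset.univ.map ⟨s, hinj⟩, ∑ᶠ σ ∈ (p.comp ψ).missing z, W.wt σ := by
        rw [Finset.sum_map]
        rfl
    _ ≤ ∑ z, ∑ᶠ σ ∈ (p.comp ψ).missing z, W.wt σ :=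
        Finset.sum_le_univ_sum_of_nonneg fun _ => Nat.zero_le _

/-! ### The coherence theorem -/

theorem Weighting.PerimeterReductionHypothesis.exists_perimeter_lt {W : X.Weighting}
    (hX : W.PerimeterReductionHypothesis) {p : Hom Y X} (hp : p.IsCovering) (A : Y.Subcomplex)
    (hc : A.toComplex.IsCompact) (hA : A.toComplex.IsConnected) (h : ¬ A.incl.PiOneInjective) :
    ∃ B : Y.Subcomplex, A ≤ B ∧ B.toComplex.IsCompact ∧ B.toComplex.IsConnected ∧
      W.perimeter (p.comp B.incl) < W.perimeter (p.comp A.incl) := by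
  obtain ⟨y⟩ := hA.1
  have himm : (p.comp A.incl).IsOneImmersion := fun v d hd d' hd' e => by
    refine A.incl_onDart_injective (hp.dart_unique ?_ e)
    rw [A.incl.map_org, A.incl.map_org]
    exact congrArg _ (Eq.trans hd (Eq.symm hd'))
  -- If the composite were injective on fundamental groups, so would be its first factor.
  have hinj : ¬ (p.comp A.incl).PiOneInjective := by
    refine fun h' => h fun v a b hab => h' v ?_
    have e := p.mapFundGroup_comp A.incl (z := v) rfl rfl rfl
    exact (e a).trans ((congrArg _ hab).trans (e b).symm)
  obtain ⟨Z, ι, φ, z, hι, hφ, hcomp, hZc, hZ, hlt, hrange⟩ :=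
    hX _ (p.comp A.incl) y _ rfl hc hA himm hinj
  obtain ⟨ψ, rfl, hψz⟩ := hp.exists_lift_hom φ hZ (z := z) (y := A.incl.onVert y) hφ.symm (by
    intro l hl
    -- A loop of `Z` has its class in the image of the group of `A`, by `hrange`, hence in that of
    -- the cover, so it lifts to a closed path.
    refine hp.exists_closed_lift (v := A.incl.onVert y) rfl (hφ ▸ φ.isPath_map hl) ?_
    have hmem : φ.mapFundGroup hφ (FundGroup.mk l hl) ∈
        ((p.comp A.incl).mapFundGroup (rfl : _ = (p.comp A.incl).onVert y)).range :=
      hrange ▸ ⟨_, rfl⟩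
    obtain ⟨a, ha⟩ := hmem
    exact ⟨_, (p.mapFundGroup_comp A.incl rfl rfl rfl a).symm.trans ha⟩)
  -- Both sides lift the same map and agree at `y`; consequently the image of `ψ` contains `A`.
  have hlift : ψ.comp ι = A.incl :=
    hp.lift_hom_unique hA (z := y) ((congrArg ψ.onVert hι).trans hψz) hcomp
  refine ⟨ψ.image, ⟨fun v hv => ?_, fun e he => ?_, fun c hc => ?_⟩, ψ.isCompact_image hZc,
    ψ.isConnected_image hZ, (W.perimeter_image_le p ψ hZc).trans_lt hlt⟩
  · exact ⟨ι.onVert ⟨v, hv⟩, congrFun (congrArg Hom.onVert hlift) ⟨v, hv⟩⟩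
  · refine ⟨(ι.onDart (⟨e, he⟩, true)).1, ?_⟩
    rw [← ψ.fst_onDart]
    exact congrArg Prod.fst (congrFun (congrArg Hom.onDart hlift) (⟨e, he⟩, true))
  -- Any side of `c` would do; `0` is one.
  · exact ⟨ι.onFlag ⟨⟨c, hc⟩, 0, true⟩,
      congrArg Sigma.fst (congrFun (congrArg Hom.onFlag hlift) ⟨⟨c, hc⟩, 0, true⟩)⟩

theorem Weighting.exists_minimal_perimeter (W : X.Weighting) (p : Hom Y X) (hY : Y.IsConnected)
    (C : Y.Subcomplex) (hC : C.toComplex.IsCompact) :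
    ∃ A : Y.Subcomplex, C ≤ A ∧ A.toComplex.IsCompact ∧ A.toComplex.IsConnected ∧
      ∀ B : Y.Subcomplex, C ≤ B → B.toComplex.IsCompact → B.toComplex.IsConnected →
        W.perimeter (p.comp A.incl) ≤ W.perimeter (p.comp B.incl) := by
  obtain ⟨A, ⟨h₁, h₂, h₃⟩, hmin⟩ := exists_minimalFor_of_wellFoundedLT
    (fun A : Y.Subcomplex => C ≤ A ∧ A.toComplex.IsCompact ∧ A.toComplex.IsConnected)
    (fun A => W.perimeter (p.comp A.incl)) (Subcomplex.exists_connected_le hY C hC)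
  refine ⟨A, h₁, h₂, h₃, fun B h₁ h₂ h₃ => ?_⟩
  -- Minimality only concerns competitors of no larger perimeter; totality of the order covers the
  -- rest.
  rcases le_total (W.perimeter (p.comp A.incl)) (W.perimeter (p.comp B.incl)) with h | h
  · exact h
  · exact hmin ⟨h₁, h₂, h₃⟩ h

theorem Weighting.PerimeterReductionHypothesis.isCoherentGroup {W : X.Weighting}
    (hX : W.PerimeterReductionHypothesis) (x : X.Vert) : IsCoherentGroup (X.FundGroup x) := by
  intro H hH
  obtain ⟨S, hS, hSfin⟩ := (Subgroup.fg_iff H).1 hH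
  obtain ⟨Y, p, y, rfl, hp, hY, rfl⟩ := exists_covering_of_subgroup H
  have hloop : ∀ g ∈ S, ∃ l : List Y.Dart, ∃ hl : IsPath y l y,
      p.mapFundGroup rfl (FundGroup.mk l hl) = g := by
    intro g hg
    obtain ⟨a, rfl⟩ : g ∈ (p.mapFundGroup (rfl : p.onVert y = _)).range :=
      hS ▸ Subgroup.subset_closure hg
    obtain ⟨l, hl, rfl⟩ := FundGroup.mk_surjective a
    exact ⟨l, hl, rfl⟩
  choose! L hL hLg using hloop
  let D : Set Y.Dart := ⋃ g ∈ S, {d | d ∈ L g}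
  have hD : D.Finite := hSfin.biUnion fun g _ => List.finite_toSet _
  -- Adding `y` keeps the base vertex in `C` even when all chosen loops are empty.
  let C : Y.Subcomplex := (Subcomplex.ofDarts D).union (Subcomplex.point y)
  have hC : C.toComplex.IsCompact := Subcomplex.isCompact_toComplex
    (((hD.image _).union (hD.image _)).union (Set.finite_singleton y))
    ((hD.image _).union Set.finite_empty) (Set.finite_empty.union Set.finite_empty)
  obtain ⟨A, hCA, hAc, hA, hmin⟩ := W.exists_minimal_perimeter p hY C hC
  have hinj : A.incl.PiOneInjective := by
    by_contra h
    obtain ⟨B, hAB, hBc, hB, hlt⟩ := hX.exists_perimeter_lt hp A hAc hA h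
    exact hlt.not_ge (hmin B ⟨hCA.1.trans hAB.1, hCA.2.1.trans hAB.2.1,
      hCA.2.2.trans hAB.2.2⟩ hBc hB)
  have hy : y ∈ A.verts := hCA.1 (Or.inr rfl)
  let y' : A.toComplex.Vert := ⟨y, hy⟩
  let f : A.toComplex.FundGroup y' →* X.FundGroup (p.onVert y) :=
    (p.mapFundGroup rfl).comp (A.incl.mapFundGroup (rfl : A.incl.onVert y' = y))
  have hf : Function.Injective f := (hp.piOneInjective y).comp (hinj y')
  -- The generators of `H` are represented by loops that run inside `A`, so restricting to `A` loses
  -- nothing.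
  have hfr : f.range = (p.mapFundGroup (rfl : p.onVert y = _)).range := by
    refine le_antisymm ?_ ?_
    · rintro _ ⟨a, rfl⟩
      exact ⟨_, rfl⟩
    · rw [← hS, Subgroup.closure_le]
      intro g hg
      obtain ⟨m, hm, hml⟩ := Subcomplex.exists_path (A := A) (hL g hg) hy hy fun d hd =>
        hCA.2.1 (Or.inl ⟨d, Set.mem_biUnion hg hd, rfl⟩)
      refine ⟨FundGroup.mk m hm, ?_⟩
      rw [← hLg g hg]
      have e : A.incl.mapFundGroup (rfl : A.incl.onVert y' = y) (FundGroup.mk m hm) =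
          FundGroup.mk (L g) (hL g hg) := mk_congr hml _
      exact congrArg (p.mapFundGroup rfl) e
  rw [← hfr]
  have := isFinitelyPresented_fundGroup hAc hA y'
  exact Group.IsFinitelyPresented.equiv (MonoidHom.ofInjective hf)

end TwoComplex

theorem theorem3p3 (X : TwoComplex.{u}) (W : X.Weighting)
    (hX : W.PerimeterReductionHypothesis) :
    (∀ (Xhat : TwoComplex.{u}) (p : TwoComplex.Hom Xhat X), p.IsCovering →
      (∀ Y : Xhat.Subcomplex, Y.toComplex.IsCompact → Y.toComplex.IsConnected →
        ¬ Y.incl.PiOneInjective →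
        ∃ Y' : Xhat.Subcomplex, Y ≤ Y' ∧ Y'.toComplex.IsCompact ∧ Y'.toComplex.IsConnected ∧
          W.perimeter (p.comp Y'.incl) < W.perimeter (p.comp Y.incl)) ∧
      (Xhat.IsConnected → ∀ C : Xhat.Subcomplex, C.toComplex.IsCompact →
        ∃ Y : Xhat.Subcomplex, C ≤ Y ∧ Y.toComplex.IsCompact ∧ Y.toComplex.IsConnected ∧
          ∀ Z : Xhat.Subcomplex, C ≤ Z → Z.toComplex.IsCompact → Z.toComplex.IsConnected →
            W.perimeter (p.comp Y.incl) ≤ W.perimeter (p.comp Z.incl))) ∧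
    (∀ x : X.Vert, IsCoherentGroup (X.FundGroup x)) := by
  exact ⟨fun Xhat p hp => ⟨fun Y hc hY h => hX.exists_perimeter_lt hp Y hc hY h,
    fun hXhat C hC => W.exists_minimal_perimeter p hXhat C hC⟩, hX.isCoherentGroup⟩
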